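/- **Setting.** Let $r,s\ge 0$ be integers, $N=r+s$, and let $X=[x_{i,j}]_{1\le i,j\le N}$ be a matrix of independent indeterminates over $\mathbb{C}$. Let $X=X_-X_0X_+$ be its Gauss decomposition over $\mathbb{C}(X)$, with $X_-$ lower unitriangular, $X_0$ diagonal and $X_+$ upper unitriangular. For $0\le t\le N$ and partitions $\mu\subset\lambda\subset((N-t)^t)$, let $S^{(t)}_{\lambda/\mu}(X)$ be the minor of $X_+$ with row set $\{\mu_{t+1-a}+a : 1\le a\le t\}$ and column set $\{\lambda_{t+1-a}+a : 1\le a\le t\}$, both in increasing order; put $S^{(t)}_{\lambda/\mu}(X)=0$ if $\mu\not\subset\lambda$, and $S^{(t)}_\lambda=S^{(t)}_{\lambda/\varnothing}$. Put $h^{(t)}_d(X)=S^{(t)}_{(d)}(X)$ and $e^{(t)}_d(X)=S^{(t)}_{(1^d)}(X)$ for $d\ge0$, and $h^{(t)}_d(X)=e^{(t)}_d(X)=0$ for $d<0$. A partition $\lambda$ with $p$ diagonal cells and conjugate $\lambda'$ is written $\lambda=(\alpha\,|\,\beta)$ in Frobenius notation, where $\alpha=(\alpha_1>\dots>\alpha_p\ge0)$,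 $\beta=(\beta_1>\dots>\beta_p\ge0)$, $\alpha_i=\lambda_i-i$, $\beta_i=\lambda'_i-i$. For a tuple $\xi=(\xi_1,\dots,\xi_p)$, let ${}^-\xi$ (resp. $\xi^-$) be $\xi$ without its first (resp. last) entry, ${}^-\xi^-=({}^-\xi)^-$ for $p\ge2$, and $\xi^\vee(j)$ be $\xi$ without its $j$-th entry. **Theorem.** Let $\lambda/\mu$ be a skew partition with $\lambda\subset(s^r)$, and write $\lambda=(\alpha\,|\,\beta)$, $\mu=(\gamma\,|\,\delta)$ in Frobenius notation, with $\alpha,\beta$ of length $p$ and $\gamma,\delta$ of length $q$. (1) If $p\ge2$, then $$S^{(r)}_{(\alpha|\beta)}(X)\,S^{(r)}_{({}^-\alpha^-|{}^-\beta^-)}(X)=S^{(r)}_{(\alpha^-|\beta^-)}(X)\,S^{(r)}_{({}^-\alpha|{}^-\beta)}(X)-S^{(r)}_{({}^-\alpha|\beta^-)}(X)\,S^{(r)}_{(\alpha^-|{}^-\beta)}(X).$$ (2) If $q\ge1$ (that is, $\mu\ne\varnothing$), then $$\begin{aligned} &S^{(r)}_{(\alpha|\beta)/(\gamma|\delta)}(X)\,S^{(r)}_{({}^-\alpha|{}^-\beta)/(\gamma^-|\delta^-)}(X)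 =S^{(r)}_{(\alpha|\beta)/(\gamma^-|\delta^-)}(X)\,S^{(r)}_{({}^-\alpha|{}^-\beta)/(\gamma|\delta)}(X)\\ &\quad+\sum_{i,j=1}^{p}(-1)^{i+j}\,h^{(r+\gamma_q+1)}_{\alpha_i-\gamma_q}(X)\,e^{(r-\delta_q-1)}_{\beta_j-\delta_q}(X)\,S^{(r)}_{(\alpha^\vee(i)|{}^-\beta)/(\gamma^-|\delta^-)}(X)\,S^{(r)}_{({}^-\alpha|\beta^\vee(j))/(\gamma^-|\delta^-)}(X). \end{aligned}$$ -/

import Mathlib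

namespace NinthVariation

open Matrix

noncomputable section

/-! ### The generic matrix and its Gauss decomposition -/

/-- The field `ℂ(X)` of rational functions in the indeterminates `x_{i,j}`, `1 ≤ i, j ≤ N`. -/
abbrev RatFun (N : ℕ) : Type := FractionRing (MvPolynomial (Fin N × Fin N) ℂ)

/-- The matrix `X = [x_{i,j}]` of indeterminates. -/
def genericMatrix (N : ℕ) : Matrix (Fin N) (Fin N) (RatFun N) :=
  (mvPolynomialX (Fin N) (Fin N) ℂ).map (algebraMap _ (RatFun N))

/-- `X = X₋ X₀ X₊` with `X₋` lower unitriangular, `X₀` diagonal, `X₊` upper unitriangular. -/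
structure IsGaussDecomposition {N : ℕ} {K : Type*} [Field K]
    (X Xminus Xzero Xplus : Matrix (Fin N) (Fin N) K) : Prop where
  minus_diag : ∀ i, Xminus i i = 1
  minus_lower : ∀ i j, i < j → Xminus i j = 0
  zero_diag : Xzero.IsDiag
  plus_diag : ∀ i, Xplus i i = 1
  plus_upper : ∀ i j, j < i → Xplus i j = 0
  eq_mul : X = Xminus * Xzero * Xplus

/-- A matrix over a field whose leading principal minors do not vanish has a Gauss
decomposition. -/
theorem exists_isGaussDecomposition {K : Type*} [Field K] :
    ∀ (N : ℕ) (X : Matrix (Fin N) (Fin N) K),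
      (∀ (k : ℕ) (hk : k ≤ N),
        (X.submatrix (Fin.castLE hk) (Fin.castLE hk)).det ≠ 0) →
      ∃ L D U, IsGaussDecomposition X L D U := by
  intro N
  induction N with
  | zero =>
    intro X _
    exact ⟨1, 1, 1, by intro i; exact i.elim0, by intro i; exact i.elim0,
      isDiag_one, by intro i; exact i.elim0, by intro i; exact i.elim0,
      Subsingleton.elim _ _⟩
  | succ n ih =>
    intro X hX
    set A := X.submatrix Fin.castSucc Fin.castSucc with hA
    obtain ⟨L, D, U, hL1, hL0, hD, hU1, hU0, hLDU⟩ := ih A (by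
      intro k hk
      have := hX k (hk.trans n.le_succ)
      exact this)
    have hdet : (L * D * U).det ≠ 0 := by
      rw [← hLDU]
      have := hX n n.le_succ
      exact this
    have hLD : IsUnit (L * D).det := by
      rw [isUnit_iff_ne_zero]
      rw [det_mul] at hdet
      exact left_ne_zero_of_mul hdet
    have hDU : IsUnit (D * U).det := by
      rw [isUnit_iff_ne_zero]
      rw [Matrix.mul_assoc, det_mul] at hdet
      exact right_ne_zero_of_mul hdet
    let b : Fin n → K := fun i => X i.castSucc (Fin.last n)
    let c : Fin n → K := fun j => X (Fin.last n) j.castSucc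
    let x : Fin n → K := (L * D)⁻¹ *ᵥ b
    let y : Fin n → K := c ᵥ* (D * U)⁻¹
    have hx : (L * D) *ᵥ x = b := by
      simp only [x, mulVec_mulVec, mul_nonsing_inv _ hLD, one_mulVec]
    have hy : y ᵥ* (D * U) = c := by
      simp only [y, vecMul_vecMul, nonsing_inv_mul _ hDU, vecMul_one]
    let L' : Matrix (Fin (n + 1)) (Fin (n + 1)) K :=
      of (Fin.snoc (α := fun _ => Fin (n + 1) → K)
        (fun i => Fin.snoc (α := fun _ => K) (L i) 0) (Fin.snoc (α := fun _ => K) y 1))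
    let U' : Matrix (Fin (n + 1)) (Fin (n + 1)) K :=
      of (Fin.snoc (α := fun _ => Fin (n + 1) → K)
        (fun i => Fin.snoc (α := fun _ => K) (U i) (x i))
        (Fin.snoc (α := fun _ => K) (fun _ => 0) 1))
    let D' : Matrix (Fin (n + 1)) (Fin (n + 1)) K :=
      diagonal (Fin.snoc (α := fun _ => K) (fun i => D i i)
        (X (Fin.last n) (Fin.last n) - ∑ k, y k * D k k * x k))
    have hDd : D = diagonal (fun i => D i i) := hD.diagonal_diag.symm
    refine ⟨L', D', U', ?_, ?_, isDiag_diagonal _, ?_, ?_, ?_⟩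
    · intro i
      refine Fin.lastCases ?_ (fun i => ?_) i <;> simp [L', hL1]
    · intro i j hij
      induction i using Fin.lastCases with
      | last => exact absurd hij (by simpa using Fin.le_last j)
      | cast i =>
        induction j using Fin.lastCases with
        | last => simp [L']
        | cast j => simpa [L'] using hL0 i j (by simpa using hij)
    · intro i
      refine Fin.lastCases ?_ (fun i => ?_) i <;> simp [U', hU1]
    · intro i j hij
      induction j using Fin.lastCases with
      | last => exact absurd hij (by simpa using Fin.le_last i)
      | cast j =>
        induction i using Fin.lastCases with
        | last => simp [U']
        | cast i => simpa [U'] using hU0 i j (by simpa using hij)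
    · ext i j
      rw [mul_apply, Fin.sum_univ_castSucc]
      simp only [D', mul_diagonal, Fin.snoc_castSucc, Fin.snoc_last]
      induction i using Fin.lastCases with
      | last =>
        induction j using Fin.lastCases with
        | last => simp [L', U']
        | cast j =>
          have h := congrFun hy j
          rw [hDd] at h
          simp only [vecMul, dotProduct, diagonal_mul] at h
          simp only [L', U', of_apply, Fin.snoc_castSucc, Fin.snoc_last, mul_zero, add_zero]
          rw [← show c j = X (Fin.last n) j.castSucc from rfl, ← h]
          exact Finset.sum_congr rfl fun k _ => by ring
      | cast i =>
        induction j using Fin.lastCases with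
        | last =>
          have h := congrFun hx i
          rw [hDd] at h
          simp only [mulVec, dotProduct, mul_diagonal] at h
          simp only [L', U', of_apply, Fin.snoc_castSucc, Fin.snoc_last, zero_mul, add_zero]
          rw [← show b i = X i.castSucc (Fin.last n) from rfl, ← h]
        | cast j =>
          have h := congrFun (congrFun hLDU i) j
          rw [hDd, mul_apply] at h
          simp only [mul_diagonal] at h
          simp only [L', U', of_apply, Fin.snoc_castSucc, Fin.snoc_last, zero_mul, mul_zero,
            add_zero]
          exact h

/-- The upper unitriangular factor of an invertible matrix is unique. -/
theorem IsGaussDecomposition.plus_unique {N : ℕ} {K : Type*} [Field K]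
    {X L D U L' D' U' : Matrix (Fin N) (Fin N) K} (hX : X.det ≠ 0)
    (h : IsGaussDecomposition X L D U) (h' : IsGaussDecomposition X L' D' U') : U = U' := by
  have key : ∀ {L D U : Matrix (Fin N) (Fin N) K}, IsGaussDecomposition X L D U →
      L.det = 1 ∧ U.det = 1 ∧ D.det ≠ 0 := by
    intro L D U h
    have hL : L.det = 1 := by
      rw [det_of_isLowerTriangular L (fun i j hij => h.minus_lower i j hij)]
      simp [h.minus_diag]
    have hU : U.det = 1 := by
      rw [det_of_isUpperTriangular (fun i j hij => h.plus_upper i j hij)]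
      simp [h.plus_diag]
    refine ⟨hL, hU, fun h0 => hX ?_⟩
    rw [h.eq_mul, det_mul, det_mul, h0]
    simp
  obtain ⟨hL, hU, hD⟩ := key h
  obtain ⟨hL', hU', hD'⟩ := key h'
  have e : L * D * U = L' * D' * U' := h.eq_mul.symm.trans h'.eq_mul
  have hUu : IsUnit U.det := by simp [hU]
  have hLu' : IsUnit L'.det := by simp [hL']
  let _ := invertibleOfIsUnitDet U hUu
  let _ := invertibleOfIsUnitDet L' hLu'
  have e2 : L'⁻¹ * L * D = D' * (U' * U⁻¹) := by
    calc L'⁻¹ * L * D = L'⁻¹ * (L * D * U) * U⁻¹ := by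
          simp only [Matrix.mul_assoc, mul_nonsing_inv _ hUu, Matrix.mul_one]
      _ = L'⁻¹ * (L' * D' * U') * U⁻¹ := by rw [e]
      _ = D' * (U' * U⁻¹) := by
          simp only [← Matrix.mul_assoc, nonsing_inv_mul _ hLu', Matrix.one_mul]
  have tU : BlockTriangular U id := fun i j hij => h.plus_upper i j hij
  have tU' : BlockTriangular U' id := fun i j hij => h'.plus_upper i j hij
  have tL : BlockTriangular L OrderDual.toDual := fun i j hij => h.minus_lower i j hij
  have tL' : BlockTriangular L' OrderDual.toDual := fun i j hij => h'.minus_lower i j hij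
  have tUU : BlockTriangular (U' * U⁻¹) id :=
    tU'.mul (blockTriangular_inv_of_blockTriangular tU)
  have tLL : BlockTriangular (L'⁻¹ * L) OrderDual.toDual :=
    (blockTriangular_inv_of_blockTriangular tL').mul tL
  have hDd : D = diagonal (fun i => D i i) := h.zero_diag.diagonal_diag.symm
  have hDd' : D' = diagonal (fun i => D' i i) := h'.zero_diag.diagonal_diag.symm
  have hd' : ∀ i, D' i i ≠ 0 := by
    rw [hDd', det_diagonal, Finset.prod_ne_zero_iff] at hD'
    exact fun i => by simpa using hD' i (Finset.mem_univ i)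
  set M := U' * U⁻¹ with hM
  have hMU : M * U = U' := by
    rw [hM, Matrix.mul_assoc, nonsing_inv_mul _ hUu, Matrix.mul_one]
  have hoff : ∀ i j, i ≠ j → M i j = 0 := by
    intro i j hij
    rcases lt_or_gt_of_ne hij with hlt | hgt
    · have e3 := congrFun (congrFun e2 i) j
      rw [hDd, hDd', mul_diagonal, diagonal_mul, tLL (by simpa using hlt), zero_mul] at e3
      exact (mul_eq_zero.mp e3.symm).resolve_left (hd' i)
    · exact tUU hgt
  have hMdiag : M = diagonal (fun i => M i i) := by
    ext i j
    by_cases hij : i = j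
    · subst hij; simp
    · rw [diagonal_apply_ne _ hij, hoff i j hij]
  have hM1 : M = 1 := by
    rw [hMdiag, ← diagonal_one]
    congr 1
    funext i
    have e4 := congrFun (congrFun hMU i) i
    rw [hMdiag, diagonal_mul, h.plus_diag, h'.plus_diag, mul_one] at e4
    exact e4
  rw [← hMU, hM1, Matrix.one_mul]

theorem genericMatrix_minor_ne_zero {N k : ℕ} (hk : k ≤ N) :
    ((genericMatrix N).submatrix (Fin.castLE hk) (Fin.castLE hk)).det ≠ 0 := by
  have h : (genericMatrix N).submatrix (Fin.castLE hk) (Fin.castLE hk) =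
      (algebraMap _ (RatFun N)).mapMatrix
        ((mvPolynomialX (Fin N) (Fin N) ℂ).submatrix (Fin.castLE hk) (Fin.castLE hk)) := rfl
  rw [h, ← RingHom.map_det]
  intro h0
  have h1 := (FaithfulSMul.algebraMap_injective
    (MvPolynomial (Fin N × Fin N) ℂ) (RatFun N)) (h0.trans (map_zero _).symm)
  have h2 := congrArg
    (MvPolynomial.eval (fun p : Fin N × Fin N => (1 : Matrix (Fin N) (Fin N) ℂ) p.1 p.2)) h1
  rw [RingHom.map_det, map_zero] at h2
  have h3 : (MvPolynomial.eval
      (fun p : Fin N × Fin N => (1 : Matrix (Fin N) (Fin N) ℂ) p.1 p.2)).mapMatrix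
      ((mvPolynomialX (Fin N) (Fin N) ℂ).submatrix (Fin.castLE hk) (Fin.castLE hk)) = 1 := by
    ext i j
    simp [mvPolynomialX, one_apply, Fin.ext_iff]
  rw [h3, det_one] at h2
  exact one_ne_zero h2

theorem genericMatrix_exists_gauss (N : ℕ) :
    ∃ Xplus Xminus Xzero, IsGaussDecomposition (genericMatrix N) Xminus Xzero Xplus := by
  obtain ⟨L, D, U, h⟩ := exists_isGaussDecomposition N (genericMatrix N)
    (fun _ hk => genericMatrix_minor_ne_zero hk)
  exact ⟨U, L, D, h⟩

/-- The upper unitriangular factor `X₊` in the Gauss decomposition of the generic matrix. -/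
def genericPlus (N : ℕ) : Matrix (Fin N) (Fin N) (RatFun N) :=
  (genericMatrix_exists_gauss N).choose

theorem genericPlus_spec (N : ℕ) :
    ∃ Xminus Xzero, IsGaussDecomposition (genericMatrix N) Xminus Xzero (genericPlus N) :=
  (genericMatrix_exists_gauss N).choose_spec

/-- `genericPlus N` is the upper unitriangular factor in every Gauss decomposition of `X`. -/
theorem eq_genericPlus {N : ℕ} {L D U : Matrix (Fin N) (Fin N) (RatFun N)}
    (h : IsGaussDecomposition (genericMatrix N) L D U) : U = genericPlus N := by
  obtain ⟨L', D', h'⟩ := genericPlus_spec N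
  exact h.plus_unique (genericMatrix_minor_ne_zero le_rfl) h'

/-! ### Ninth variation of skew Schur functions -/

/-- The rectangular partition `(s^r)`, with `r` rows of length `s`. -/
def rectangle (r s : ℕ) : YoungDiagram where
  cells := Finset.range r ×ˢ Finset.range s
  isLowerSet := by
    rintro ⟨a, b⟩ ⟨c, d⟩ h hab
    simp only [Prod.mk_le_mk] at h
    simp only [Finset.coe_product, Set.mem_prod, Finset.mem_coe, Finset.mem_range] at hab ⊢
    omega

theorem mem_rectangle {r s : ℕ} {c : ℕ × ℕ} : c ∈ rectangle r s ↔ c.1 < r ∧ c.2 < s := by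
  rw [← YoungDiagram.mem_cells]
  simp [rectangle]

theorem rowLen_le_of_le_rectangle {nu : YoungDiagram} {r s : ℕ} (h : nu ≤ rectangle r s)
    (i : ℕ) : nu.rowLen i ≤ s := by
  by_contra hlt
  have hm : (i, s) ∈ nu := YoungDiagram.mem_iff_lt_rowLen.mpr (by omega)
  exact absurd (mem_rectangle.mp (h hm)).2 (lt_irrefl _)

/-- The Maya diagram of `nu ⊆ ((N - r)^r)`, listed increasingly: in `1`-based terms its `a`-th
element is `nu_{r+1-a} + a`, for `1 ≤ a ≤ r`. Here rows, columns and positions are `0`-based. -/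
def maya {N r : ℕ} (hr : r ≤ N) (nu : YoungDiagram) (h : nu ≤ rectangle r (N - r)) :
    Fin r → Fin N :=
  fun a => ⟨nu.rowLen (r - 1 - a) + a, by
    have := rowLen_le_of_le_rectangle h (r - 1 - a)
    omega⟩

open Classical in
/-- `S^{(r)}_{lam/mu}(X)` for the generic `N × N` matrix `X` and `lam ⊆ ((N - r)^r)`: the minor of
`X₊` with row set the Maya diagram of `mu` and column set the Maya diagram of `lam`. It is `0` if
`lam/mu` is not a skew partition (`mu ⊄ lam`). If `lam` does not fit in the rectangle the symbol
has no meaning and the value `0` is a dummy. -/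
def ninthSchur (N r : ℕ) (lam mu : YoungDiagram) : RatFun N :=
  if h : mu ≤ lam ∧ r ≤ N ∧ lam ≤ rectangle r (N - r) then
    ((genericPlus N).submatrix (maya h.2.1 mu (h.1.trans h.2.2)) (maya h.2.1 lam h.2.2)).det
  else 0

/-- `h^{(r)}_d(X) = S^{(r)}_{(d)}(X)`, and `0` for `d < 0`. -/
def hFun (N r : ℕ) (d : ℤ) : RatFun N :=
  if d < 0 then 0 else ninthSchur N r (rectangle 1 d.toNat) ⊥

/-- `e^{(r)}_d(X) = S^{(r)}_{(1^d)}(X)`, and `0` for `d < 0`. -/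
def eFun (N r : ℕ) (d : ℤ) : RatFun N :=
  if d < 0 then 0 else ninthSchur N r (rectangle d.toNat 1) ⊥

/-! ### Frobenius notation -/

/-- Sequences `a_1 > a_2 > ⋯ > a_p ≥ 0`. -/
abbrev DecSeq (p : ℕ) : Type := {a : Fin p → ℕ // StrictAnti a}

/-- The sequence with its `i`-th term omitted. -/
def DecSeq.remove {p : ℕ} (a : DecSeq (p + 1)) (i : Fin (p + 1)) : DecSeq p :=
  ⟨fun k => a.1 (i.succAbove k), a.2.comp_strictMono (Fin.strictMono_succAbove i)⟩

/-- `⁻a = (a_2, …, a_p)`. -/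
def DecSeq.dropFirst {p : ℕ} (a : DecSeq (p + 1)) : DecSeq p := a.remove 0

/-- `a⁻ = (a_1, …, a_{p-1})`. -/
def DecSeq.dropLast {p : ℕ} (a : DecSeq (p + 1)) : DecSeq p := a.remove (Fin.last p)

/-- `lam = (a | b)` in Frobenius notation: `lam` has `p` diagonal cells, and `a_i = lam_i - i`,
`b_i = lam'_i - i` for `1 ≤ i ≤ p` (written here with `0`-based indices). -/
structure HasFrobenius {p : ℕ} (lam : YoungDiagram) (a b : DecSeq p) : Prop where
  card_diag : (lam.cells.filter fun c => c.1 = c.2).card = p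
  arm : ∀ i : Fin p, lam.rowLen i = a.1 i + i + 1
  leg : ∀ i : Fin p, lam.colLen i = b.1 i + i + 1

theorem DecSeq.add_le {p : ℕ} (a : DecSeq p) {i j : Fin p} (h : i ≤ j) :
    a.1 j + j ≤ a.1 i + i := by
  obtain ⟨i, hi⟩ := i
  obtain ⟨j, hj⟩ := j
  simp only [Fin.mk_le_mk] at h
  induction j, h using Nat.le_induction with
  | base => exact le_rfl
  | succ k hk ih =>
    have h1 := ih (by omega)
    have h2 : a.1 ⟨k + 1, hj⟩ < a.1 ⟨k, by omega⟩ := a.2 (by simp [Fin.lt_def])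
    simp only at h1 ⊢
    omega

/-- The partition `(a | b)`: the union over `k` of the hooks with corner `(k, k)`, arm length
`a_k` and leg length `b_k`. -/
def frobeniusDiagram {p : ℕ} (a b : DecSeq p) : YoungDiagram where
  cells := Finset.univ.biUnion fun k : Fin p =>
    ((Finset.range (a.1 k + 1)).image fun t => ((k : ℕ), (k : ℕ) + t)) ∪
      ((Finset.range (b.1 k + 1)).image fun t => ((k : ℕ) + t, (k : ℕ)))
  isLowerSet := by
    rintro ⟨x, y⟩ ⟨u, v⟩ h hxy
    simp only [Prod.mk_le_mk] at h
    simp only [Finset.coe_biUnion, Finset.coe_univ, Set.mem_univ, Set.iUnion_true,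
      Set.mem_iUnion, Finset.coe_union, Finset.coe_image, Set.mem_union, Set.mem_image,
      Finset.mem_coe, Finset.mem_range, Prod.mk.injEq] at hxy ⊢
    obtain ⟨k, hk⟩ := hxy
    have hkp := k.2
    rcases le_total u v with huv | huv
    · have huk : u ≤ k := by rcases hk with ⟨t, ht⟩ | ⟨t, ht⟩ <;> omega
      have ha := a.add_le (i := ⟨u, by omega⟩) (j := k) huk
      have hb := b.add_le (i := ⟨u, by omega⟩) (j := k) huk
      refine ⟨⟨u, by omega⟩, Or.inl ⟨v - u, ?_, rfl, ?_⟩⟩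
      · simp only at ha hb ⊢
        rcases hk with ⟨t, ht⟩ | ⟨t, ht⟩ <;> omega
      · simp only; omega
    · have hvk : v ≤ k := by rcases hk with ⟨t, ht⟩ | ⟨t, ht⟩ <;> omega
      have ha := a.add_le (i := ⟨v, by omega⟩) (j := k) hvk
      have hb := b.add_le (i := ⟨v, by omega⟩) (j := k) hvk
      refine ⟨⟨v, by omega⟩, Or.inr ⟨u - v, ?_, ?_, rfl⟩⟩
      · simp only at ha hb ⊢
        rcases hk with ⟨t, ht⟩ | ⟨t, ht⟩ <;> omega
      · simp only; omega

theorem mem_frobeniusDiagram {p : ℕ} {a b : DecSeq p} {x y : ℕ} :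
    (x, y) ∈ frobeniusDiagram a b ↔
      ∃ k : Fin p, (x = k ∧ k ≤ y ∧ y ≤ k + a.1 k) ∨ (y = k ∧ k ≤ x ∧ x ≤ k + b.1 k) := by
  rw [← YoungDiagram.mem_cells]
  simp only [frobeniusDiagram, Finset.mem_biUnion, Finset.mem_univ, true_and, Finset.mem_union,
    Finset.mem_image, Finset.mem_range, Prod.mk.injEq]
  refine exists_congr fun k => or_congr ⟨?_, fun h => ⟨y - k, by omega⟩⟩
    ⟨?_, fun h => ⟨x - k, by omega⟩⟩
  · rintro ⟨t, ht⟩; omega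
  · rintro ⟨t, ht⟩; omega

/-- A partition is `(a | b)` in Frobenius notation iff it is the union of the hooks. -/
theorem hasFrobenius_iff {p : ℕ} {lam : YoungDiagram} {a b : DecSeq p} :
    HasFrobenius lam a b ↔ lam = frobeniusDiagram a b := by
  have diag_card : ∀ (nu : YoungDiagram) (m : ℕ), (∀ d, (d, d) ∈ nu ↔ d < m) →
      (nu.cells.filter fun c => c.1 = c.2).card = m := by
    intro nu m h
    have : (nu.cells.filter fun c => c.1 = c.2) = (Finset.range m).image fun d => (d, d) := by
      ext ⟨x, y⟩
      simp only [Finset.mem_filter, YoungDiagram.mem_cells, Finset.mem_image, Finset.mem_range,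
        Prod.mk.injEq]
      constructor
      · rintro ⟨h1, rfl⟩
        exact ⟨x, (h x).mp h1, rfl, rfl⟩
      · rintro ⟨d, hd, rfl, rfl⟩
        exact ⟨(h d).mpr hd, rfl⟩
    rw [this, Finset.card_image_of_injective _ (fun x y hxy => (Prod.mk.inj hxy).1),
      Finset.card_range]
  constructor
  · rintro ⟨hc, ha, hb⟩
    -- the diagonal cells form an initial segment
    have hex : ∃ d, (d, d) ∉ lam := by
      by_contra hall
      push Not at hall
      have := hall (lam.rowLen 0)
      have h2 := lam.up_left_mem (Nat.zero_le _) le_rfl this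
      exact absurd (YoungDiagram.mem_iff_lt_rowLen.mp h2) (lt_irrefl _)
    classical
    have hm : ∀ d, (d, d) ∈ lam ↔ d < Nat.find hex := by
      intro d
      constructor
      · intro hd
        by_contra hlt
        exact Nat.find_spec hex (lam.up_left_mem (not_lt.mp hlt) (not_lt.mp hlt) hd)
      · intro hd
        exact not_not.mp (Nat.find_min hex hd)
    have hp : ∀ d, (d, d) ∈ lam ↔ d < p := by
      rw [diag_card lam _ hm] at hc
      rwa [hc] at hm
    apply SetLike.ext
    rintro ⟨x, y⟩
    rw [mem_frobeniusDiagram]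
    constructor
    · intro hxy
      rcases le_total x y with h | h
      · have hx : x < p := (hp _).mp (lam.up_left_mem le_rfl h hxy)
        have h1 := YoungDiagram.mem_iff_lt_rowLen.mp hxy
        have h2 := ha ⟨x, hx⟩
        refine ⟨⟨x, hx⟩, Or.inl ⟨rfl, h, ?_⟩⟩
        simp only at h2 ⊢
        omega
      · have hy : y < p := (hp _).mp (lam.up_left_mem h le_rfl hxy)
        have h1 := YoungDiagram.mem_iff_lt_colLen.mp hxy
        have h2 := hb ⟨y, hy⟩
        refine ⟨⟨y, hy⟩, Or.inr ⟨rfl, h, ?_⟩⟩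
        simp only at h2 ⊢
        omega
    · rintro ⟨k, ⟨rfl, h1, h2⟩ | ⟨rfl, h1, h2⟩⟩
      · rw [YoungDiagram.mem_iff_lt_rowLen, ha]; omega
      · rw [YoungDiagram.mem_iff_lt_colLen, hb]; omega
  · rintro rfl
    refine ⟨diag_card _ _ fun d => ?_, fun i => ?_, fun i => ?_⟩
    · rw [mem_frobeniusDiagram]
      constructor
      · rintro ⟨k, h⟩
        have := k.2
        omega
      · intro hd
        exact ⟨⟨d, hd⟩, Or.inl ⟨rfl, le_rfl, Nat.le_add_right _ _⟩⟩
    · have hrow : ∀ y, (↑i, y) ∈ frobeniusDiagram a b ↔ y < a.1 i + i + 1 := by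
        intro y
        rw [mem_frobeniusDiagram]
        constructor
        · rintro ⟨k, h⟩
          by_cases hik : i = k
          · subst hik; omega
          · have : (i : ℕ) ≠ k := fun e => hik (Fin.ext e)
            omega
        · intro hy
          by_cases hiy : (i : ℕ) ≤ y
          · exact ⟨i, Or.inl ⟨rfl, hiy, by omega⟩⟩
          · have hi := i.2
            refine ⟨⟨y, by omega⟩, Or.inr ⟨rfl, by simp only; omega, ?_⟩⟩
            have := b.add_le (i := ⟨y, by omega⟩) (j := i) (by simp only [Fin.le_def]; omega)
            simp only at this ⊢
            omega
      have h1 := hrow ((frobeniusDiagram a b).rowLen i)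
      have h2 := hrow (a.1 i + i + 1)
      rw [YoungDiagram.mem_iff_lt_rowLen] at h1 h2
      omega
    · have hcol : ∀ x, (x, ↑i) ∈ frobeniusDiagram a b ↔ x < b.1 i + i + 1 := by
        intro x
        rw [mem_frobeniusDiagram]
        constructor
        · rintro ⟨k, h⟩
          by_cases hik : i = k
          · subst hik; omega
          · have : (i : ℕ) ≠ k := fun e => hik (Fin.ext e)
            omega
        · intro hx
          by_cases hix : (i : ℕ) ≤ x
          · exact ⟨i, Or.inr ⟨rfl, hix, by omega⟩⟩
          · have hi := i.2
            refine ⟨⟨x, by omega⟩, Or.inl ⟨rfl, by simp only; omega, ?_⟩⟩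
            have := a.add_le (i := ⟨x, by omega⟩) (j := i) (by simp only [Fin.le_def]; omega)
            simp only at this ⊢
            omega
      have h1 := hcol ((frobeniusDiagram a b).colLen i)
      have h2 := hcol (b.1 i + i + 1)
      rw [YoungDiagram.mem_iff_lt_colLen] at h1 h2
      omega

end

end NinthVariation

open NinthVariation

namespace NinthVariation

open Matrix

/-! ### Determinantal identities -/

/-! The Maya diagram of `(α|β)` inside a rectangle with `r` rows is `{0, …, r - 1}` with each `r - 1
- β_j` replaced by `r + α_j`. Hence, after sorting, the minor defining `S_{(α|β)/(γ|δ)}` is the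
leading `r × r` block `A` of `X₊` in which a few columns and a few rows have been exchanged for
others. The new rows vanish on the old columns because `X₊` is upper triangular, and `det A = 1`.
The matrix determinant lemma then compresses the minor to a determinant whose size is the number of
replaced rows plus the number of replaced columns (`det_replace_rows_cols`,
`det_maya_eq_frobeniusDet`): `S = ± det [[0, -H(γ_k, α_i)], [E(β_j, δ_l), P(β_j, α_i)]]`, where `H`
is an entry of `X₊`, `E` an entry of `A⁻¹`, and `P` an entry of `A⁻¹` times the first `r` rows of
`X₊`. The sign comes from the sorting permutations (`exists_perm_rowLen`).

In this form each part of the theorem is a Desnanot–Jacobi identity. Part (1) is the case of the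
matrix `P` with its first and last rows and columns. For part (2) the distinguished lines are the
row of `γ_q` with the column of `δ_q`, and the row of `β_1` with the column of `α_1`. The two mixed
minors are expanded along the row of `γ_q` and the column of `δ_q`, which meet the zero block; this
produces the double sum. Finally `H` and `E` at `γ_q` and `δ_q` are recognised as row and column
functions, the latter up to sign (`hFun_eq_rowEntry`, `eFun_eq_colEntry`), and all signs are seen to
agree. -/

theorem det_fromBlocks_mul_det_pow {R l n : Type*} [CommRing R] [Fintype l] [DecidableEq l]
    [Fintype n] [DecidableEq n] (x : Matrix l l R) (u : Matrix l n R) (v : Matrix n l R)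
    (D : Matrix n n R) :
    (fromBlocks x u v D).det * D.det ^ Fintype.card l =
      (D.det • x - u * (D.adjugate * v)).det * D.det := by
  -- Block column elimination with `adjugate D` in place of `D⁻¹`: it clears the lower left block
  -- over any commutative ring, at the cost of a power of `det D`.
  have h : fromBlocks x u v D * fromBlocks (D.det • (1 : Matrix l l R)) 0 (-(D.adjugate * v)) 1 =
      fromBlocks (D.det • x - u * (D.adjugate * v)) u 0 D := by
    rw [fromBlocks_multiply]
    congr 1
    · simp [sub_eq_add_neg]
    · simp
    · rw [Matrix.mul_neg, ← Matrix.mul_assoc, mul_adjugate]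
      simp
    · simp
  have h2 := congrArg det h
  rw [det_mul, det_fromBlocks_zero₁₂, det_fromBlocks_zero₂₁, det_smul, det_one, det_one] at h2
  simpa using h2

/-- The Schur complement of `D` is a `2 × 2` matrix whose entries are the four bordered minors, so
the identity is the formula for a `2 × 2` determinant. Regularity of `det D` allows the surplus
factor to be cancelled. -/
theorem desnanot_jacobi_of_isRegular {R n : Type*} [CommRing R] [Fintype n] [DecidableEq n]
    (x : Matrix (Fin 2) (Fin 2) R) (u : Matrix (Fin 2) n R) (v : Matrix n (Fin 2) R)
    (D : Matrix n n R) (hD : IsRegular D.det) :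
    (fromBlocks x u v D).det * D.det =
      (fromBlocks (of fun _ _ : Unit => x 0 0) (of fun _ => u 0) (of fun j _ => v j 0) D).det *
        (fromBlocks (of fun _ _ : Unit => x 1 1) (of fun _ => u 1) (of fun j _ => v j 1) D).det -
      (fromBlocks (of fun _ _ : Unit => x 0 1) (of fun _ => u 0) (of fun j _ => v j 1) D).det *
        (fromBlocks (of fun _ _ : Unit => x 1 0) (of fun _ => u 1) (of fun j _ => v j 0)
          D).det := by
  have single : ∀ i j : Fin 2,
      (fromBlocks (of fun _ _ : Unit => x i j) (of fun _ => u i) (of fun k _ => v k j) D).det =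
        (D.det • x - u * (D.adjugate * v)) i j := by
    intro i j
    have h := det_fromBlocks_mul_det_pow (of fun _ _ : Unit => x i j) (of fun _ => u i)
      (of fun k _ => v k j) D
    rw [Fintype.card_unit, pow_one] at h
    rw [hD.right h, det_unique]
    simp [mul_apply]
  have h := det_fromBlocks_mul_det_pow x u v D
  rw [Fintype.card_fin, pow_two, ← mul_assoc] at h
  rw [hD.right h, det_fin_two]
  simp only [single]

/-- The **Desnanot–Jacobi identity**. -/
theorem desnanot_jacobi {R n : Type*} [CommRing R] [Fintype n] [DecidableEq n]
    (x : Matrix (Fin 2) (Fin 2) R) (u : Matrix (Fin 2) n R) (v : Matrix n (Fin 2) R)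
    (D : Matrix n n R) :
    (fromBlocks x u v D).det * D.det =
      (fromBlocks (of fun _ _ : Unit => x 0 0) (of fun _ => u 0) (of fun j _ => v j 0) D).det *
        (fromBlocks (of fun _ _ : Unit => x 1 1) (of fun _ => u 1) (of fun j _ => v j 1) D).det -
      (fromBlocks (of fun _ _ : Unit => x 0 1) (of fun _ => u 0) (of fun j _ => v j 1) D).det *
        (fromBlocks (of fun _ _ : Unit => x 1 0) (of fun _ => u 1) (of fun j _ => v j 0)
          D).det := by
  -- Over `R[X]` the matrix `D` is deformed to `X + D`, the characteristic matrix of `-D`. Its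
  -- determinant is monic, hence regular; evaluation at `X = 0` recovers the general case.
  have hreg : IsRegular (charmatrix (-D)).det := (charpoly_monic (-D)).isRegular
  have h := desnanot_jacobi_of_isRegular (x.map Polynomial.C) (u.map Polynomial.C)
    (v.map Polynomial.C) (charmatrix (-D)) hreg
  have h2 := congrArg (Polynomial.evalRingHom 0) h
  have hD : (charmatrix (-D)).map (Polynomial.evalRingHom (0 : R)) = D := by
    ext i j
    by_cases hij : i = j
    · subst hij; simp
    · simp [hij]
  simp only [map_sub, map_mul, RingHom.map_det, RingHom.mapMatrix_apply, fromBlocks_map, hD] at h2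
  convert h2 using 6 <;> ext <;> simp

theorem det_fromBlocks_expand_row {R : Type*} [CommRing R] {q p : ℕ}
    (A : Matrix (Fin q) (Fin q) R) (B : Matrix (Fin q) (Fin (p + 1)) R)
    (C : Matrix (Fin (p + 1)) (Fin q) R) (D : Matrix (Fin (p + 1)) (Fin (p + 1)) R)
    (hC : ∀ j, C 0 j = 0) :
    (fromBlocks A B C D).det = ∑ i : Fin (p + 1), (-1) ^ (i : ℕ) * D 0 i *
      (fromBlocks A (B.submatrix id i.succAbove) (C.submatrix Fin.succ id)
        (D.submatrix Fin.succ i.succAbove)).det := by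
  have hadd : ∀ i : Fin (p + 1), ∀ k : Fin q,
      Fin.succAbove (n := q + p) (Fin.natAdd q i) (Fin.castAdd p k) = Fin.castAdd (p + 1) k := by
    intro i k
    rw [Fin.succAbove_of_castSucc_lt]
    · ext; simp
    · simp only [Fin.lt_def, Fin.val_castSucc, Fin.val_castAdd, Fin.val_natAdd]; omega
  have hnat : ∀ i : Fin (p + 1), ∀ k : Fin p,
      Fin.succAbove (n := q + p) (Fin.natAdd q i) (Fin.natAdd q k) =
        Fin.natAdd q (i.succAbove k) := by
    intro i k
    ext
    simp only [Fin.succAbove, Fin.lt_def, Fin.val_castSucc, Fin.val_natAdd, add_lt_add_iff_left]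
    split_ifs <;> simp [add_assoc]
  rw [← det_submatrix_equiv_self (finSumFinEquiv (m := q) (n := p + 1)).symm]
  refine (det_succ_row (n := q + p) _ (Fin.natAdd q (0 : Fin (p + 1)))).trans ?_
  refine (Fin.sum_univ_add (a := q) (b := p + 1) _).trans ?_
  rw [Finset.sum_eq_zero, zero_add]
  · refine Finset.sum_congr rfl fun i _ => ?_
    rw [← det_submatrix_equiv_self (finSumFinEquiv (m := q) (n := p))]
    -- The row and the column are both offset by `q`, so the offsets cancel modulo 2.
    have hsign : (-1 : R) ^ (((Fin.natAdd q (0 : Fin (p + 1)) : Fin (q + (p + 1))) : ℕ) +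
        ((Fin.natAdd q i : Fin (q + (p + 1))) : ℕ)) = (-1) ^ (i : ℕ) := by
      simp [← add_assoc, ← two_mul, pow_add, pow_mul]
    rw [hsign]
    congr 2
    · simp
    · ext a b
      rcases a with a | a <;> rcases b with b | b <;>
        simp [hadd, hnat]
  · intro j _
    simp [hC]

theorem det_fromBlocks_expand_col {R : Type*} [CommRing R] {q p : ℕ}
    (A : Matrix (Fin q) (Fin q) R) (B : Matrix (Fin q) (Fin (p + 1)) R)
    (C : Matrix (Fin (p + 1)) (Fin q) R) (D : Matrix (Fin (p + 1)) (Fin (p + 1)) R)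
    (hB : ∀ j, B j 0 = 0) :
    (fromBlocks A B C D).det = ∑ i : Fin (p + 1), (-1) ^ (i : ℕ) * D i 0 *
      (fromBlocks A (B.submatrix id Fin.succ) (C.submatrix i.succAbove id)
        (D.submatrix i.succAbove Fin.succ)).det := by
  rw [← det_transpose, fromBlocks_transpose, det_fromBlocks_expand_row _ _ _ _ (by simpa using hB)]
  refine Finset.sum_congr rfl fun i _ => ?_
  rw [← det_transpose, fromBlocks_transpose]
  rfl

/-! ### Replacing rows and columns of a matrix -/

theorem mul_selection_apply {R l m p : Type*} [CommRing R] [DecidableEq m] [Fintype p]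
    {b : p → m} (hb : b.Injective) (F : Matrix l p R) (i : l) (k : p) :
    (F * ((1 : Matrix m m R).submatrix id b)ᵀ) i (b k) = F i k := by
  classical
  simp [mul_apply, one_apply, hb.eq_iff]

theorem mul_selection_apply_of_notMem {R l m p : Type*} [CommRing R] [DecidableEq m] [Fintype p]
    {b : p → m} (F : Matrix l p R) (i : l) {k : m}
    (hk : k ∉ Set.range b) : (F * ((1 : Matrix m m R).submatrix id b)ᵀ) i k = 0 := by
  rw [mul_apply]
  refine Finset.sum_eq_zero fun j _ => ?_
  have : k ≠ b j := fun e => hk ⟨j, e.symm⟩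
  simp [this]

theorem selection_mul_apply {R l m p : Type*} [CommRing R] [DecidableEq m] [Fintype p]
    {b : p → m} (hb : b.Injective) (F : Matrix p l R) (i : p) (k : l) :
    ((1 : Matrix m m R).submatrix id b * F) (b i) k = F i k := by
  classical
  simp [mul_apply, one_apply, hb.eq_iff]

theorem selection_mul_apply_of_notMem {R l m p : Type*} [CommRing R] [DecidableEq m] [Fintype p]
    {b : p → m} (F : Matrix p l R) {i : m} (k : l)
    (hi : i ∉ Set.range b) : ((1 : Matrix m m R).submatrix id b * F) i k = 0 := by
  rw [mul_apply]
  refine Finset.sum_eq_zero fun j _ => ?_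
  have : i ≠ b j := fun e => hi ⟨j, e.symm⟩
  simp [this]

theorem selection_transpose_mul_apply {R l m p : Type*} [CommRing R] [Fintype m]
    [DecidableEq m] {b : p → m} (F : Matrix m l R) (i : p) (k : l) :
    (((1 : Matrix m m R).submatrix id b)ᵀ * F) i k = F (b i) k := by
  simp [mul_apply, one_apply]

/-- The determinant of the matrix obtained from `A` by replacing its columns `b` by `B` and its
rows `d` by zero, except for the block `C` at the crossings. -/
theorem det_replace_rows_cols {R m p q : Type*} [CommRing R] [Fintype m] [DecidableEq m]
    [Fintype p] [DecidableEq p] [Fintype q] [DecidableEq q]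
    (A M : Matrix m m R) (B : Matrix m p R) (C : Matrix q p R) {b : p → m} {d : q → m}
    (hb : b.Injective) (hd : d.Injective) (hA : IsUnit A.det)
    (h00 : ∀ i k, i ∉ Set.range d → k ∉ Set.range b → M i k = A i k)
    (h01 : ∀ i k, i ∉ Set.range d → M i (b k) = B i k)
    (h10 : ∀ i k, k ∉ Set.range b → M (d i) k = 0)
    (h11 : ∀ i k, M (d i) (b k) = C i k) :
    M.det = A.det * (fromBlocks 0 (-C) (A⁻¹.submatrix b d) ((A⁻¹ * B).submatrix b id)).det := by
  set Eb : Matrix m p R := (1 : Matrix m m R).submatrix id b with hEb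
  set Ed : Matrix m q R := (1 : Matrix m m R).submatrix id d with hEd
  set T : Matrix q p R := Edᵀ * (B - A * Eb) with hT
  have hbb : Ebᵀ * Eb = 1 := by
    ext i j
    simp [hEb, mul_apply, one_apply, hb.eq_iff]
  have hdd : Edᵀ * Ed = 1 := by
    ext i j
    simp [hEd, mul_apply, one_apply, hd.eq_iff]
  -- A perturbation of `A` of low rank. The term `(B - A * Eb) * Ebᵀ` exchanges the columns `b`,
  -- `-Ed * Edᵀ * A` erases the rows `d`, and `C - T` corrects the crossings, where the column
  -- exchange has left an extra `T`.
  have hM : M = A + fromCols Ed (B - A * Eb) * fromRows (-(Edᵀ * A) + (C - T) * Ebᵀ) Ebᵀ := by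
    rw [fromCols_mul_fromRows]
    have hAE : ∀ i k, (A * Eb) i k = A i (b k) := by
      intro i k; simp [hEb, mul_apply, one_apply]
    ext i k
    rw [Matrix.add_apply, Matrix.add_apply]
    by_cases hi : i ∈ Set.range d <;> by_cases hk : k ∈ Set.range b
    · obtain ⟨i, rfl⟩ := hi
      obtain ⟨k, rfl⟩ := hk
      rw [h11, selection_mul_apply hd, mul_selection_apply hb, Matrix.add_apply,
        mul_selection_apply hb, Matrix.neg_apply, selection_transpose_mul_apply, Matrix.sub_apply,
        hT, selection_transpose_mul_apply]
      ring
    · obtain ⟨i, rfl⟩ := hi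
      rw [h10 _ _ hk, selection_mul_apply hd, mul_selection_apply_of_notMem _ _ hk,
        Matrix.add_apply, mul_selection_apply_of_notMem _ _ hk, Matrix.neg_apply,
        selection_transpose_mul_apply]
      ring
    · obtain ⟨k, rfl⟩ := hk
      rw [h01 _ _ hi, selection_mul_apply_of_notMem _ _ hi, mul_selection_apply hb,
        Matrix.sub_apply, hAE]
      ring
    · rw [h00 _ _ hi hk, selection_mul_apply_of_notMem _ _ hi,
        mul_selection_apply_of_notMem _ _ hk]
      ring
  have hQ : Ebᵀ * A⁻¹ * Ed = A⁻¹.submatrix b d := by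
    ext i k; simp [hEb, hEd, mul_apply, one_apply]
  have hP : Ebᵀ * A⁻¹ * B = (A⁻¹ * B).submatrix b id := by
    ext i k; rw [Matrix.mul_assoc]; simp [hEb, mul_apply, one_apply]
  have hAA : A⁻¹ * A = 1 := nonsing_inv_mul _ hA
  have hAA' : A * A⁻¹ = 1 := mul_nonsing_inv _ hA
  rw [hM, det_add_mul _ _ hA]
  congr 1
  have e1 : Edᵀ * A * A⁻¹ = Edᵀ := by rw [Matrix.mul_assoc, hAA', Matrix.mul_one]
  have e2 : Ebᵀ * A⁻¹ * (A * Eb) = 1 := by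
    rw [Matrix.mul_assoc, ← Matrix.mul_assoc A⁻¹, hAA, Matrix.one_mul, hbb]
  -- The small matrix given by the matrix determinant lemma differs from the desired one by a block
  -- unitriangular factor, which does not affect the determinant.
  have key : 1 + fromRows (-(Edᵀ * A) + (C - T) * Ebᵀ) Ebᵀ * A⁻¹ * fromCols Ed (B - A * Eb) =
      fromBlocks 1 (C - T) 0 1 *
        fromBlocks 0 (-C) (A⁻¹.submatrix b d) ((A⁻¹ * B).submatrix b id) := by
    rw [fromRows_mul, fromRows_mul_fromCols, ← fromBlocks_one, fromBlocks_add, fromBlocks_multiply,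
      ← hQ, ← hP]
    congr 1
    · rw [Matrix.add_mul, Matrix.add_mul, Matrix.neg_mul, Matrix.neg_mul, e1, hdd]
      simp only [Matrix.mul_assoc]
      simp
    · rw [Matrix.add_mul, Matrix.add_mul, Matrix.neg_mul, Matrix.neg_mul, e1, ← hT,
        Matrix.mul_assoc (C - T), Matrix.mul_assoc (C - T), Matrix.mul_sub, e2, Matrix.mul_sub]
      simp only [Matrix.mul_one, Matrix.one_mul]
      abel
    · simp
    · rw [Matrix.mul_sub, e2]
      simp
  rw [key, det_mul, det_fromBlocks_zero₂₁]
  simp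

/-- A minor of an upper triangular matrix with increasing rows and columns vanishes if some row
index exceeds the column index in the same place. -/
theorem det_eq_zero_of_upper {R : Type*} [CommRing R] {r : ℕ} (M : Matrix (Fin r) (Fin r) R)
    (k : Fin r) (h : ∀ i j, k ≤ i → j ≤ k → M i j = 0) : M.det = 0 := by
  rw [det_apply]
  refine Finset.sum_eq_zero fun σ _ => ?_
  -- Pigeonhole: `σ` cannot map the `k + 1` indices up to `k` into the `k` indices below `k`. So
  -- every term of the determinant has a factor in the zero region.
  have : ∃ j, j ≤ k ∧ k ≤ σ j := by
    by_contra hcon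
    push Not at hcon
    have hsub : (Finset.Iic k).image σ ⊆ Finset.Iio k := by
      intro i hi
      simp only [Finset.mem_image, Finset.mem_Iic] at hi
      obtain ⟨j, hj, rfl⟩ := hi
      exact Finset.mem_Iio.mpr (hcon j hj)
    have := Finset.card_le_card hsub
    rw [Finset.card_image_of_injective _ σ.injective, Fin.card_Iic, Fin.card_Iio] at this
    omega
  obtain ⟨j, hj, hk⟩ := this
  have h0 : ∏ i, M (σ i) i = 0 := Finset.prod_eq_zero (Finset.mem_univ j) (h _ _ hk hj)
  rw [h0, smul_zero]

/-! ### Identities for determinants in Frobenius coordinates -/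

/-- Different reindexings of rows and columns may change each determinant by a sign; it is the same
sign for both factors, so the product is unaffected. -/
theorem det_submatrix_mul_det_submatrix {R m n : Type*} [CommRing R] [Fintype m] [DecidableEq m]
    [Fintype n] [DecidableEq n] (A B : Matrix m m R) (e f : n ≃ m) :
    (A.submatrix e f).det * (B.submatrix f e).det = A.det * B.det := by
  rw [← det_mul, submatrix_mul_equiv, det_submatrix_equiv_self, det_mul]

/-- `Fin (n + 1)` with the element `i` set apart. -/
noncomputable def unitSumFinEquiv {n : ℕ} (i : Fin (n + 1)) : Unit ⊕ Fin n ≃ Fin (n + 1) :=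
  Equiv.ofBijective (Sum.elim (fun _ => i) i.succAbove) <| by
    rw [Fintype.bijective_iff_injective_and_card]
    constructor
    · rintro (_ | a) (_ | b) h <;> simp_all [Fin.succAbove_ne, (Fin.succAbove_ne _ _).symm]
    · simp [add_comm]

@[simp] theorem unitSumFinEquiv_inl {n : ℕ} (i : Fin (n + 1)) (u : Unit) :
    unitSumFinEquiv i (Sum.inl u) = i := rfl

@[simp] theorem unitSumFinEquiv_inr {n : ℕ} (i : Fin (n + 1)) (k : Fin n) :
    unitSumFinEquiv i (Sum.inr k) = i.succAbove k := rfl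

/-- `Fin (n + 2)` with its first and last elements set apart. -/
noncomputable def finTwoSumFinEquiv (n : ℕ) : Fin 2 ⊕ Fin n ≃ Fin (n + 2) :=
  Equiv.ofBijective (Sum.elim ![0, Fin.last (n + 1)] fun k => k.castSucc.succ) <| by
    rw [Fintype.bijective_iff_injective_and_card]
    constructor
    · rintro (a | a) (b | b) h
      · fin_cases a <;> fin_cases b <;> simp_all [Fin.ext_iff]
      · fin_cases a <;> simp [Fin.ext_iff] at h
        omega
      · fin_cases b <;> simp [Fin.ext_iff] at h
        omega
      · simpa using h
    · simp [add_comm]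

/-- The Desnanot–Jacobi identity for the first and last rows and columns. -/
theorem desnanot_jacobi_first_last {R : Type*} [CommRing R] {n : ℕ}
    (M : Matrix (Fin (n + 2)) (Fin (n + 2)) R) :
    M.det * (M.submatrix (fun k : Fin n => k.castSucc.succ) fun k : Fin n => k.castSucc.succ).det =
      (M.submatrix Fin.castSucc Fin.castSucc).det * (M.submatrix Fin.succ Fin.succ).det -
      (M.submatrix Fin.castSucc Fin.succ).det * (M.submatrix Fin.succ Fin.castSucc).det := by
  set mid : Fin n → Fin (n + 2) := fun k => k.castSucc.succ with hmid
  have h := desnanot_jacobi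
    (M.submatrix ![0, Fin.last (n + 1)] ![0, Fin.last (n + 1)])
    (M.submatrix ![0, Fin.last (n + 1)] mid) (M.submatrix mid ![0, Fin.last (n + 1)])
    (M.submatrix mid mid)
  -- In a mixed minor the distinguished row and column stand at opposite ends. Moving both to the
  -- front may cost a sign, which cancels between the two mixed minors.
  rw [← det_submatrix_equiv_self (finTwoSumFinEquiv n) M,
    ← det_submatrix_equiv_self (unitSumFinEquiv (0 : Fin (n + 1)))
      (M.submatrix Fin.castSucc Fin.castSucc),
    ← det_submatrix_equiv_self (unitSumFinEquiv (Fin.last n)) (M.submatrix Fin.succ Fin.succ),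
    ← det_submatrix_mul_det_submatrix _ _ (unitSumFinEquiv (0 : Fin (n + 1)))
      (unitSumFinEquiv (Fin.last n))]
  convert h using 4
  · ext (i | i) (j | j) <;> rfl
  all_goals ext (i | i) (j | j) <;> simp [mid]

/-- The determinant expressing a ninth variation skew Schur function in Frobenius notation through
the functions of rows, columns and hooks. -/
noncomputable def frobeniusDet {R : Type*} [CommRing R] (H E P : ℕ → ℕ → R) {p q : ℕ}
    (α β : Fin p → ℕ) (γ δ : Fin q → ℕ) : R :=
  (fromBlocks 0 (of fun k i => -H (γ k) (α i)) (of fun j l => E (β j) (δ l))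
    (of fun j i => P (β j) (α i))).det

theorem frobeniusDet_zero {R : Type*} [CommRing R] (H E P : ℕ → ℕ → R) {p : ℕ}
    (α β : Fin p → ℕ) (γ δ : Fin 0 → ℕ) :
    frobeniusDet H E P α β γ δ = (of fun j i => P (β j) (α i)).det := by
  rw [frobeniusDet, ← det_submatrix_equiv_self (Equiv.emptySum (Fin 0) (Fin p)).symm]
  rfl

theorem frobeniusDet_hook_identity {R : Type*} [CommRing R] (H E P : ℕ → ℕ → R) {p : ℕ}
    (α β : Fin (p + 2) → ℕ) (γ δ : Fin 0 → ℕ) :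
    frobeniusDet H E P α β γ δ *
        frobeniusDet H E P (fun k : Fin p => α k.castSucc.succ) (fun k => β k.castSucc.succ) γ δ =
      frobeniusDet H E P (α ∘ Fin.castSucc) (β ∘ Fin.castSucc) γ δ *
          frobeniusDet H E P (α ∘ Fin.succ) (β ∘ Fin.succ) γ δ -
        frobeniusDet H E P (α ∘ Fin.succ) (β ∘ Fin.castSucc) γ δ *
          frobeniusDet H E P (α ∘ Fin.castSucc) (β ∘ Fin.succ) γ δ := by
  simp only [frobeniusDet_zero]
  exact desnanot_jacobi_first_last (of fun j i => P (β j) (α i))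

/-- `Fin (q + 1) ⊕ Fin (p + 1)` with the last element of the first summand and the first element
of the second one set apart. -/
noncomputable def finTwoSumSumEquiv (q p : ℕ) :
    Fin 2 ⊕ (Fin q ⊕ Fin p) ≃ Fin (q + 1) ⊕ Fin (p + 1) :=
  Equiv.ofBijective
    (Sum.elim ![Sum.inl (Fin.last q), Sum.inr 0] (Sum.map Fin.castSucc Fin.succ)) <| by
    rw [Fintype.bijective_iff_injective_and_card]
    constructor
    · rintro (a | a | a) (b | b | b) h
      · fin_cases a <;> fin_cases b <;> simp_all
      all_goals first
        | (fin_cases a <;> simp [Fin.ext_iff] at h <;> omega)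
        | (fin_cases b <;> simp [Fin.ext_iff] at h <;> omega)
        | simp_all
    · simp
      omega

/-- `Fin (q + 1) ⊕ Fin p` with the last element of the first summand set apart. -/
noncomputable def unitSumLastEquiv (q p : ℕ) : Unit ⊕ (Fin q ⊕ Fin p) ≃ Fin (q + 1) ⊕ Fin p :=
  (Equiv.sumAssoc _ _ _).symm.trans (Equiv.sumCongr (unitSumFinEquiv (Fin.last q)) (Equiv.refl _))

/-- `Fin q ⊕ Fin (p + 1)` with the first element of the second summand set apart. -/
noncomputable def unitSumFirstEquiv (q p : ℕ) : Unit ⊕ (Fin q ⊕ Fin p) ≃ Fin q ⊕ Fin (p + 1) :=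
  (Equiv.sumAssoc _ _ _).symm.trans <| (Equiv.sumCongr (Equiv.sumComm _ _) (Equiv.refl _)).trans <|
    (Equiv.sumAssoc _ _ _).trans (Equiv.sumCongr (Equiv.refl _) (unitSumFinEquiv 0))

/-- Desnanot–Jacobi for the last line of the first block and the first line of the second. Each
mixed minor retains a row or column with a zero part, along which it is expanded. The minus sign in
front of `H` turns the subtracted product into an added sum. -/
theorem frobeniusDet_skew_identity {R : Type*} [CommRing R] (H E P : ℕ → ℕ → R) {p q : ℕ}
    (α β : Fin (p + 1) → ℕ) (γ δ : Fin (q + 1) → ℕ) :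
    frobeniusDet H E P α β γ δ *
        frobeniusDet H E P (α ∘ Fin.succ) (β ∘ Fin.succ) (γ ∘ Fin.castSucc) (δ ∘ Fin.castSucc) =
      frobeniusDet H E P α β (γ ∘ Fin.castSucc) (δ ∘ Fin.castSucc) *
          frobeniusDet H E P (α ∘ Fin.succ) (β ∘ Fin.succ) γ δ +
        ∑ i : Fin (p + 1), ∑ j : Fin (p + 1), (-1) ^ ((i : ℕ) + (j : ℕ)) *
          H (γ (Fin.last q)) (α i) * E (β j) (δ (Fin.last q)) *
          frobeniusDet H E P (α ∘ i.succAbove) (β ∘ Fin.succ) (γ ∘ Fin.castSucc)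
            (δ ∘ Fin.castSucc) *
          frobeniusDet H E P (α ∘ Fin.succ) (β ∘ j.succAbove) (γ ∘ Fin.castSucc)
            (δ ∘ Fin.castSucc) := by
  set M : Matrix (Fin (q + 1) ⊕ Fin (p + 1)) (Fin (q + 1) ⊕ Fin (p + 1)) R :=
    fromBlocks 0 (of fun k i => -H (γ k) (α i)) (of fun j l => E (β j) (δ l))
      (of fun j i => P (β j) (α i)) with hM
  set x : Fin 2 → Fin (q + 1) ⊕ Fin (p + 1) := ![Sum.inl (Fin.last q), Sum.inr 0] with hx
  set y : Fin q ⊕ Fin p → Fin (q + 1) ⊕ Fin (p + 1) := Sum.map Fin.castSucc Fin.succ with hy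
  have h := desnanot_jacobi (M.submatrix x x) (M.submatrix x y) (M.submatrix y x) (M.submatrix y y)
  have hfull : (fromBlocks (M.submatrix x x) (M.submatrix x y) (M.submatrix y x)
      (M.submatrix y y)).det = frobeniusDet H E P α β γ δ := by
    rw [frobeniusDet, ← det_submatrix_equiv_self (finTwoSumSumEquiv q p)]
    congr 1
    ext (i | i) (j | j) <;> rfl
  have hcore : (M.submatrix y y).det = frobeniusDet H E P (α ∘ Fin.succ) (β ∘ Fin.succ)
      (γ ∘ Fin.castSucc) (δ ∘ Fin.castSucc) := by
    rw [frobeniusDet]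
    congr 1
    ext (i | i) (j | j) <;> rfl
  have h00 : (fromBlocks (of fun _ _ : Unit => M.submatrix x x 0 0) (of fun _ => M.submatrix x y 0)
      (of fun j _ => M.submatrix y x j 0) (M.submatrix y y)).det =
      frobeniusDet H E P (α ∘ Fin.succ) (β ∘ Fin.succ) γ δ := by
    rw [frobeniusDet, ← det_submatrix_equiv_self (unitSumLastEquiv q p)]
    congr 1
    ext (i | i | i) (j | j | j) <;> simp [unitSumLastEquiv, M, x, y]
  have h11 : (fromBlocks (of fun _ _ : Unit => M.submatrix x x 1 1) (of fun _ => M.submatrix x y 1)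
      (of fun j _ => M.submatrix y x j 1) (M.submatrix y y)).det =
      frobeniusDet H E P α β (γ ∘ Fin.castSucc) (δ ∘ Fin.castSucc) := by
    rw [frobeniusDet, ← det_submatrix_equiv_self (unitSumFirstEquiv q p)]
    congr 1
    ext (i | i | i) (j | j | j) <;> simp [unitSumFirstEquiv, M, x, y]
  have h01 : (fromBlocks (of fun _ _ : Unit => M.submatrix x x 0 1) (of fun _ => M.submatrix x y 0)
      (of fun j _ => M.submatrix y x j 1) (M.submatrix y y)).det =
      ∑ i : Fin (p + 1), (-1) ^ (i : ℕ) * (-H (γ (Fin.last q)) (α i)) *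
        frobeniusDet H E P (α ∘ i.succAbove) (β ∘ Fin.succ) (γ ∘ Fin.castSucc)
          (δ ∘ Fin.castSucc) := by
    -- The row of `γ (Fin.last q)` takes the place of the omitted row of `β 0`, so that it becomes
    -- the first row of the second block.
    have := det_fromBlocks_expand_row 0 (of fun (k : Fin q) i => -H (γ k.castSucc) (α i))
      (of (Fin.cons (fun _ => 0) fun j (l : Fin q) => E (β j.succ) (δ l.castSucc)))
      (of (Fin.cons (fun i => -H (γ (Fin.last q)) (α i)) fun j i => P (β j.succ) (α i)))
      (fun _ => rfl)
    refine Eq.trans ?_ (this.trans ?_)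
    · rw [← det_submatrix_equiv_self (unitSumFirstEquiv q p)]
      congr 1
      ext (i | i | i) (j | j | j) <;> simp [unitSumFirstEquiv, M, x, y]
    · rfl
  have h10 : (fromBlocks (of fun _ _ : Unit => M.submatrix x x 1 0) (of fun _ => M.submatrix x y 1)
      (of fun j _ => M.submatrix y x j 0) (M.submatrix y y)).det =
      ∑ j : Fin (p + 1), (-1) ^ (j : ℕ) * E (β j) (δ (Fin.last q)) *
        frobeniusDet H E P (α ∘ Fin.succ) (β ∘ j.succAbove) (γ ∘ Fin.castSucc)
          (δ ∘ Fin.castSucc) := by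
    -- Likewise the column of `δ (Fin.last q)` takes the place of the omitted column of `α 0`.
    have := det_fromBlocks_expand_col 0
      (of fun (k : Fin q) => Fin.cons 0 fun i => -H (γ k.castSucc) (α i.succ))
      (of fun j (l : Fin q) => E (β j) (δ l.castSucc))
      (of fun j => Fin.cons (E (β j) (δ (Fin.last q))) fun i => P (β j) (α i.succ))
      (fun _ => rfl)
    refine Eq.trans ?_ (this.trans ?_)
    · rw [← det_submatrix_equiv_self (unitSumFirstEquiv q p)]
      congr 1
      ext (i | i | i) (j | j | j) <;> simp [unitSumFirstEquiv, M, x, y]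
    · rfl
  rw [hfull, hcore, h00, h11, h01, h10, Finset.sum_mul_sum] at h
  rw [h, sub_eq_add_neg, mul_comm (frobeniusDet H E P (α ∘ Fin.succ) (β ∘ Fin.succ) γ δ)]
  congr 1
  rw [← Finset.sum_neg_distrib]
  refine Finset.sum_congr rfl fun i _ => ?_
  rw [← Finset.sum_neg_distrib]
  refine Finset.sum_congr rfl fun j _ => ?_
  rw [pow_add]
  ring

/-! ### Maya diagrams in Frobenius notation -/

theorem rowLen_eq_of_mem_iff {nu : YoungDiagram} {x n : ℕ} (h : ∀ y, (x, y) ∈ nu ↔ y < n) :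
    nu.rowLen x = n := by
  have h1 := h (nu.rowLen x)
  have h2 := h n
  rw [YoungDiagram.mem_iff_lt_rowLen] at h1 h2
  omega

theorem DecSeq.dropFirst_apply {p : ℕ} (a : DecSeq (p + 1)) (k : Fin p) :
    a.dropFirst.1 k = a.1 k.succ := by
  simp [DecSeq.dropFirst, DecSeq.remove]

theorem DecSeq.dropLast_apply {p : ℕ} (a : DecSeq (p + 1)) (k : Fin p) :
    a.dropLast.1 k = a.1 k.castSucc := by
  simp [DecSeq.dropLast, DecSeq.remove]

theorem DecSeq.dropFirst_lt {p : ℕ} (a : DecSeq (p + 1)) (k : Fin p) :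
    a.dropFirst.1 k < a.1 0 := by
  rw [a.dropFirst_apply]
  exact a.2 (Fin.succ_pos k)

/-- Stripping the outermost hook, that is, the first row and column, leaves the diagram of the
remaining hooks shifted diagonally by one. This is the recursion behind `exists_perm_rowLen`. -/
theorem mem_frobeniusDiagram_succ {p : ℕ} {α β : DecSeq (p + 1)} {x y : ℕ} :
    (x, y) ∈ frobeniusDiagram α β ↔ (x = 0 ∧ y ≤ α.1 0) ∨ (y = 0 ∧ x ≤ β.1 0) ∨
      ∃ x' y', x = x' + 1 ∧ y = y' + 1 ∧
        (x', y') ∈ frobeniusDiagram α.dropFirst β.dropFirst := by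
  simp only [mem_frobeniusDiagram, Fin.exists_fin_succ, DecSeq.dropFirst_apply, Fin.val_zero,
    Fin.val_succ]
  constructor
  · rintro (h | ⟨k, h⟩)
    · omega
    · exact Or.inr (Or.inr ⟨x - 1, y - 1, by omega, by omega, k, by omega⟩)
  · rintro (h | h | ⟨x', y', rfl, rfl, k, h⟩)
    · omega
    · omega
    · exact Or.inr ⟨k, by omega⟩

theorem rowLen_frobeniusDiagram_zero {p : ℕ} (α β : DecSeq (p + 1)) :
    (frobeniusDiagram α β).rowLen 0 = α.1 0 + 1 := by
  refine rowLen_eq_of_mem_iff fun y => ?_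
  rw [mem_frobeniusDiagram_succ]
  constructor
  · rintro (h | h | ⟨x', y', h, -⟩) <;> omega
  · intro h
    exact Or.inl ⟨rfl, by omega⟩

/-- The bound `i < β.1 0` says that row `i + 1` still meets the first column, which accounts for the
added cell. -/
theorem rowLen_frobeniusDiagram_succ {p : ℕ} (α β : DecSeq (p + 1)) {i : ℕ} (hi : i < β.1 0) :
    (frobeniusDiagram α β).rowLen (i + 1) =
      (frobeniusDiagram α.dropFirst β.dropFirst).rowLen i + 1 := by
  refine rowLen_eq_of_mem_iff fun y => ?_
  rw [mem_frobeniusDiagram_succ]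
  constructor
  · rintro (h | h | ⟨x', y', h, rfl, h'⟩)
    · omega
    · omega
    · obtain rfl : i = x' := by omega
      rw [YoungDiagram.mem_iff_lt_rowLen] at h'
      omega
  · intro h
    rcases y with _ | y
    · exact Or.inr (Or.inl ⟨rfl, by omega⟩)
    · exact Or.inr (Or.inr ⟨i, y, rfl, rfl, YoungDiagram.mem_iff_lt_rowLen.mpr (by omega)⟩)

theorem rowLen_frobeniusDiagram_eq_zero {p : ℕ} (α β : DecSeq p) {i : ℕ} (hi : ∀ j, β.1 j + j < i) :
    (frobeniusDiagram α β).rowLen i = 0 := by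
  refine rowLen_eq_of_mem_iff fun y => ?_
  rw [mem_frobeniusDiagram]
  constructor
  · rintro ⟨k, h⟩
    have := hi k
    omega
  · omega

theorem frobeniusDiagram_le_rectangle {p r s : ℕ} {α β : DecSeq p} :
    frobeniusDiagram α β ≤ rectangle r s ↔ ∀ k, α.1 k + k < s ∧ β.1 k + k < r := by
  constructor
  · intro h k
    have h1 := mem_rectangle.mp
      (h (mem_frobeniusDiagram.mpr ⟨k, Or.inl ⟨rfl, Nat.le_add_right _ (α.1 k), le_rfl⟩⟩))
    have h2 := mem_rectangle.mp
      (h (mem_frobeniusDiagram.mpr ⟨k, Or.inr ⟨rfl, Nat.le_add_right _ (β.1 k), le_rfl⟩⟩))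
    simp only at h1 h2
    omega
  · rintro h ⟨x, y⟩ hxy
    obtain ⟨k, hk⟩ := mem_frobeniusDiagram.mp hxy
    have := h k
    rw [mem_rectangle]
    simp only
    omega

theorem frobeniusDiagram_remove_le_rectangle {p r s : ℕ} {α β : DecSeq (p + 1)}
    (h : frobeniusDiagram α β ≤ rectangle r s) (i j : Fin (p + 1)) :
    frobeniusDiagram (α.remove i) (β.remove j) ≤ rectangle r s := by
  rw [frobeniusDiagram_le_rectangle] at h ⊢
  -- Omitting a term moves the later terms to smaller positions, so position plus value does not
  -- increase.
  have hle : ∀ (i : Fin (p + 1)) (k : Fin p), (k : ℕ) ≤ (i.succAbove k : ℕ) := by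
    intro i k
    unfold Fin.succAbove
    split_ifs <;> simp
  intro k
  have h1 := (h (i.succAbove k)).1
  have h2 := (h (j.succAbove k)).2
  have h3 := hle i k
  have h4 := hle j k
  simp only [DecSeq.remove]
  omega

/-- The permutation that sorts `0, …, r - 1` with `r - 1 - β_j` replaced by `r + α_j`. -/
theorem exists_perm_rowLen {r : ℕ} : ∀ {p : ℕ} (α β : DecSeq p), (∀ j, β.1 j + j < r) →
    ∃ π : Equiv.Perm (Fin r), Equiv.Perm.sign π = (-1) ^ (∑ j, β.1 j) ∧
      (∀ k : Fin r, (∀ j, (k : ℕ) + β.1 j + 1 < r) → π k = k) ∧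
      (∀ (k : Fin r) (j), (k : ℕ) + β.1 j + 1 = r →
        (frobeniusDiagram α β).rowLen (r - 1 - π k) + π k = r + α.1 j) ∧
      ∀ k : Fin r, (∀ j, (k : ℕ) + β.1 j + 1 ≠ r) →
        (frobeniusDiagram α β).rowLen (r - 1 - π k) + π k = k := by
  -- Induction on the number of hooks, adding the outermost one. The clause that `π` fixes
  -- everything below all replaced positions serves to carry the induction.
  intro p
  induction p with
  | zero =>
    intro α β _
    refine ⟨1, by simp, fun _ _ => rfl, fun _ j => j.elim0, fun k _ => ?_⟩
    rw [rowLen_frobeniusDiagram_eq_zero _ _ fun j => j.elim0]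
    simp
  | succ p ih =>
    intro α β hβ
    have hβ0 : β.1 0 < r := by simpa using hβ 0
    obtain ⟨m, rfl⟩ : ∃ m, r = m + 1 := ⟨r - 1, by omega⟩
    obtain ⟨π, hsign, hfix, hrep, hkeep⟩ := ih α.dropFirst β.dropFirst (by
      intro j
      have := hβ j.succ
      rw [β.dropFirst_apply]
      simp only [Fin.val_succ] at this
      omega)
    have hdl := β.dropFirst_lt
    have hdadd : ∀ j : Fin p, β.dropFirst.1 j + j < β.1 0 := by
      intro j
      have := β.add_le (Fin.zero_le j.succ)
      rw [β.dropFirst_apply]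
      simp only [Fin.val_succ, Fin.val_zero] at this
      omega
    have hadd : ∀ j, β.1 j + j ≤ β.1 0 := fun j => by simpa using β.add_le (Fin.zero_le j)
    -- The position `r - 1 - β_0` that the outermost hook replaces by `r + α_0`. The cycle `c` sends
    -- the last place to `k0` and each place from `k0` up to its successor; its sign is `(-1) ^
    -- β_0`.
    set k0 : Fin (m + 1) := ⟨m - β.1 0, by omega⟩ with hk0
    have hk0l : k0 ≤ Fin.last m := Fin.le_last _
    set c := Fin.cycleIcc k0 (Fin.last m) with hc
    -- Maya diagrams before and after the outermost hook is stripped: the largest element is `r +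
    -- α_0`, and every other one is the element of the inner diagram at place `c a`.
    have star : ∀ a : Fin (m + 1), (frobeniusDiagram α β).rowLen (m + 1 - 1 - a) + a =
        if c a = k0 then m + 1 + α.1 0 else
          (frobeniusDiagram α.dropFirst β.dropFirst).rowLen (m + 1 - 1 - c a) + c a := by
      intro a
      rcases lt_or_ge a k0 with ha | ha
      · have hca : c a = a := Fin.cycleIcc_of_lt ha
        have ha' : (a : ℕ) < m - β.1 0 := ha
        rw [hca, if_neg ha.ne, rowLen_frobeniusDiagram_eq_zero, rowLen_frobeniusDiagram_eq_zero]
        · intro j; have := hdadd j; omega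
        · intro j; have := hadd j; omega
      · have ha' : m - β.1 0 ≤ (a : ℕ) := ha
        rcases (Fin.le_last a).lt_or_eq with hl | rfl
        · have hl' : (a : ℕ) < m := hl
          have hca : c a = a + 1 := Fin.cycleIcc_of_ge_of_lt ha hl
          have hval : ((a + 1 : Fin (m + 1)) : ℕ) = a + 1 := Fin.val_add_one_of_lt hl
          have hne : a + 1 ≠ k0 := by
            intro h
            have := congrArg Fin.val h
            rw [hval] at this
            simp only [hk0] at this
            omega
          rw [hca, if_neg hne, hval, show m + 1 - 1 - (a : ℕ) = (m + 1 - 1 - (a + 1)) + 1 by omega,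
            rowLen_frobeniusDiagram_succ _ _ (by omega)]
          omega
        · have hca : c (Fin.last m) = k0 := Fin.cycleIcc_of_last hk0l
          rw [if_pos hca]
          simp only [Fin.val_last, Nat.add_sub_cancel, Nat.sub_self, rowLen_frobeniusDiagram_zero]
          omega
    -- The remaining `β_j` are smaller than `β_0`, so `k0` lies below every position replaced by the
    -- inner hooks.
    have hπ0 : π k0 = k0 := hfix k0 fun j => by
      have := hdl j
      simp only [hk0]
      omega
    have hπne : ∀ k, k ≠ k0 → π k ≠ k0 := fun k hk h => hk (π.injective (h.trans hπ0.symm))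
    have hcc : ∀ y, c (c⁻¹ y) = y := c.apply_symm_apply
    refine ⟨c⁻¹ * π, ?_, ?_, ?_, ?_⟩
    · rw [Equiv.Perm.sign_mul, Equiv.Perm.sign_inv, hc, Fin.sign_cycleIcc_of_le hk0l, hsign,
        Fin.sum_univ_succ, pow_add]
      have h0 : ((Fin.last m : Fin (m + 1)) : ℕ) - k0 = β.1 0 := by
        simp only [hk0, Fin.val_last]
        omega
      rw [h0, Finset.sum_congr rfl fun j _ => β.dropFirst_apply j]
    · intro k hk
      have h0 := hk 0
      have hlt : k < k0 := by
        rw [Fin.lt_def]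
        simp only [hk0]
        omega
      rw [Equiv.Perm.mul_apply, hfix k fun j => by
        have := hdl j
        omega, Equiv.Perm.inv_eq_iff_eq]
      exact (Fin.cycleIcc_of_lt hlt).symm
    · intro k j hkj
      rw [Equiv.Perm.mul_apply, star, hcc]
      refine Fin.cases (fun hkj => ?_) (fun j hkj => ?_) j hkj
      · have : k = k0 := Fin.ext (by simp only [hk0]; omega)
        rw [this, if_pos hπ0]
      · have hlt : β.1 j.succ < β.1 0 := β.2 (Fin.succ_pos j)
        have hne : k ≠ k0 := by
          rintro rfl
          simp only [hk0] at hkj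
          omega
        rw [if_neg (hπne k hne), hrep k j (by rw [β.dropFirst_apply]; exact hkj),
          α.dropFirst_apply]
    · intro k hk
      have hne : k ≠ k0 := by
        rintro rfl
        have := hk 0
        simp only [hk0] at this
        omega
      rw [Equiv.Perm.mul_apply, star, hcc, if_neg (hπne k hne)]
      exact hkeep k fun j => by rw [β.dropFirst_apply]; exact hk j.succ

/-! ### Minors of an upper unitriangular matrix -/

/-- The entry of `M` in row `i` and column `j`, and `0` outside `M`. -/
def natEntry {R : Type*} [Zero R] {m n : ℕ} (M : Matrix (Fin m) (Fin n) R) (i j : ℕ) : R :=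
  if h : i < m ∧ j < n then M ⟨i, h.1⟩ ⟨j, h.2⟩ else 0

theorem natEntry_eq {R : Type*} [Zero R] {m n : ℕ} (M : Matrix (Fin m) (Fin n) R) {i j : ℕ}
    (hi : i < m) (hj : j < n) : natEntry M i j = M ⟨i, hi⟩ ⟨j, hj⟩ :=
  dif_pos ⟨hi, hj⟩

/-- Upper unitriangular matrices. -/
structure IsUpperUnitriangular {R : Type*} [Zero R] [One R] {n : ℕ}
    (U : Matrix (Fin n) (Fin n) R) : Prop where
  diag : ∀ i, U i i = 1
  lower : ∀ i j, j < i → U i j = 0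

namespace IsUpperUnitriangular

variable {R : Type*} [CommRing R] {n : ℕ} {U : Matrix (Fin n) (Fin n) R}

theorem det_eq_one (hU : IsUpperUnitriangular U) : U.det = 1 := by
  rw [det_of_isUpperTriangular fun i j hij => hU.lower i j hij]
  simp [hU.diag]

theorem isUnit_det (hU : IsUpperUnitriangular U) : IsUnit U.det := by
  simp [hU.det_eq_one]

theorem truncate (hU : IsUpperUnitriangular U) {m : ℕ} (hm : m ≤ n) :
    IsUpperUnitriangular (U.submatrix (Fin.castLE hm) (Fin.castLE hm)) :=
  ⟨fun _ => hU.diag _, fun _ _ hij => hU.lower _ _ (by simpa using hij)⟩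

theorem inv_lower (hU : IsUpperUnitriangular U) {i j : Fin n} (hij : j < i) : U⁻¹ i j = 0 := by
  let _ := invertibleOfIsUnitDet U hU.isUnit_det
  have tU : BlockTriangular U id := fun i j hij => hU.lower i j hij
  exact blockTriangular_inv_of_blockTriangular tU hij

/-- The product of the leading blocks differs from the leading block of `U * U⁻¹` only by terms
containing entries of `U⁻¹` below the diagonal. -/
theorem inv_truncate (hU : IsUpperUnitriangular U) {m : ℕ} (hm : m ≤ n) :
    (U.submatrix (Fin.castLE hm) (Fin.castLE hm))⁻¹ =
      U⁻¹.submatrix (Fin.castLE hm) (Fin.castLE hm) := by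
  refine inv_eq_right_inv ?_
  obtain ⟨k, rfl⟩ := Nat.exists_eq_add_of_le hm
  ext i j
  have h := congrFun (congrFun (mul_nonsing_inv U hU.isUnit_det) (Fin.castLE hm i))
    (Fin.castLE hm j)
  rw [mul_apply, Fin.sum_univ_add, Finset.sum_eq_zero (s := Finset.univ (α := Fin k)),
    add_zero] at h
  · rw [mul_apply]
    refine h.trans ?_
    simp [one_apply, Fin.ext_iff]
  · intro l _
    rw [hU.inv_lower, mul_zero]
    simp only [Fin.lt_def, Fin.val_castLE, Fin.val_natAdd]
    omega

end IsUpperUnitriangular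

theorem maya_val {N r : ℕ} (hr : r ≤ N) (nu : YoungDiagram) (h : nu ≤ rectangle r (N - r))
    (a : Fin r) : (maya hr nu h a : ℕ) = nu.rowLen (r - 1 - a) + a := rfl

theorem maya_strictMono {N r : ℕ} (hr : r ≤ N) (nu : YoungDiagram)
    (h : nu ≤ rectangle r (N - r)) : StrictMono (maya hr nu h) := by
  intro a b hab
  have hab' : (a : ℕ) < b := hab
  have := nu.rowLen_anti (r - 1 - b) (r - 1 - a) (by omega)
  rw [Fin.lt_def, maya_val, maya_val]
  omega

/-- The entries of `U` with row and column indices at least `r`. -/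
def rowEntry {R : Type*} [CommRing R] {N : ℕ} (U : Matrix (Fin N) (Fin N) R) (r : ℕ)
    (γ α : ℕ) : R :=
  natEntry U (r + γ) (r + α)

/-- The entries of the inverse of the leading `r × r` block, with rows and columns numbered
backwards. -/
noncomputable def colEntry {R : Type*} [CommRing R] {N r : ℕ} (hr : r ≤ N)
    (U : Matrix (Fin N) (Fin N) R) (β δ : ℕ) : R :=
  natEntry (U.submatrix (Fin.castLE hr) (Fin.castLE hr))⁻¹ (r - 1 - β) (r - 1 - δ)

/-- The entries of the inverse of the leading `r × r` block times the first `r` rows. -/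
noncomputable def hookEntry {R : Type*} [CommRing R] {N r : ℕ} (hr : r ≤ N)
    (U : Matrix (Fin N) (Fin N) R) (β α : ℕ) : R :=
  natEntry ((U.submatrix (Fin.castLE hr) (Fin.castLE hr))⁻¹ * U.submatrix (Fin.castLE hr) id)
    (r - 1 - β) (r + α)

/-- After the sorting permutations are undone, the minor is the leading block with columns `b` and
rows `d` exchanged, so `det_replace_rows_cols` applies. The sign is the product of the signs of the
two permutations. -/
theorem det_maya_eq_frobeniusDet {R : Type*} [CommRing R] {N r : ℕ} (hr : r ≤ N)
    {U : Matrix (Fin N) (Fin N) R} (hU : IsUpperUnitriangular U) {p q : ℕ} {α β : DecSeq p}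
    {γ δ : DecSeq q} (hlam : frobeniusDiagram α β ≤ rectangle r (N - r))
    (hmu : frobeniusDiagram γ δ ≤ rectangle r (N - r)) :
    (U.submatrix (maya hr _ hmu) (maya hr _ hlam)).det =
      (-1) ^ (∑ j, β.1 j + ∑ l, δ.1 l) *
        frobeniusDet (rowEntry U r) (colEntry hr U) (hookEntry hr U) α.1 β.1 γ.1 δ.1 := by
  have hl := frobeniusDiagram_le_rectangle.mp hlam
  have hm := frobeniusDiagram_le_rectangle.mp hmu
  obtain ⟨π, hπs, -, hπr, hπk⟩ := exists_perm_rowLen α β fun j => (hl j).2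
  obtain ⟨ρ, hρs, -, hρr, hρk⟩ := exists_perm_rowLen γ δ fun j => (hm j).2
  set a : Fin p → Fin N := fun j => ⟨r + α.1 j, by have := (hl j).1; omega⟩ with ha
  set c : Fin q → Fin N := fun j => ⟨r + γ.1 j, by have := (hm j).1; omega⟩ with hc
  set b : Fin p → Fin r := fun j => ⟨r - 1 - β.1 j, by have := (hl j).2; omega⟩ with hb
  set d : Fin q → Fin r := fun j => ⟨r - 1 - δ.1 j, by have := (hm j).2; omega⟩ with hd
  have hbinj : b.Injective := by
    intro i j hij
    have h1 := (hl i).2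
    have h2 := (hl j).2
    simp only [hb, Fin.mk.injEq] at hij
    exact β.2.injective (by omega)
  have hdinj : d.Injective := by
    intro i j hij
    have h1 := (hm i).2
    have h2 := (hm j).2
    simp only [hd, Fin.mk.injEq] at hij
    exact δ.2.injective (by omega)
  have colr : ∀ j, maya hr _ hlam (π (b j)) = a j := by
    intro j
    ext
    rw [maya_val]
    exact hπr (b j) j (by have := (hl j).2; simp only [hb]; omega)
  have rowr : ∀ j, maya hr _ hmu (ρ (d j)) = c j := by
    intro j
    ext
    rw [maya_val]
    exact hρr (d j) j (by have := (hm j).2; simp only [hd]; omega)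
  have colk : ∀ k, k ∉ Set.range b → maya hr _ hlam (π k) = Fin.castLE hr k := by
    intro k hk
    ext
    rw [maya_val]
    refine hπk k fun j hj => hk ⟨j, Fin.ext ?_⟩
    simp only [hb]
    omega
  have rowk : ∀ k, k ∉ Set.range d → maya hr _ hmu (ρ k) = Fin.castLE hr k := by
    intro k hk
    ext
    rw [maya_val]
    refine hρk k fun j hj => hk ⟨j, Fin.ext ?_⟩
    simp only [hd]
    omega
  have key := det_replace_rows_cols (U.submatrix (Fin.castLE hr) (Fin.castLE hr))
    ((U.submatrix (maya hr _ hmu) (maya hr _ hlam)).submatrix ρ π)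
    (U.submatrix (Fin.castLE hr) a) (U.submatrix c a) hbinj hdinj (hU.truncate hr).isUnit_det
    (fun i k hi hk => by simp only [submatrix_apply, colk k hk, rowk i hi])
    (fun i k hi => by simp only [submatrix_apply, colr, rowk i hi])
    -- The new rows have index at least `r` and the kept columns index below `r`, so these entries
    -- lie under the diagonal of `U`.
    (fun i k hk => by
      simp only [submatrix_apply, colk k hk, rowr]
      refine hU.lower _ _ ?_
      simp only [Fin.lt_def, Fin.val_castLE, hc]
      omega)
    (fun i k => by simp only [submatrix_apply, colr, rowr])
  have hperm : ((U.submatrix (maya hr _ hmu) (maya hr _ hlam)).submatrix ρ π).det =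
      (-1) ^ (∑ j, β.1 j + ∑ l, δ.1 l) *
        (U.submatrix (maya hr _ hmu) (maya hr _ hlam)).det := by
    rw [← submatrix_id_id (U.submatrix (maya hr _ hmu) (maya hr _ hlam)), submatrix_submatrix,
      Function.id_comp, Function.id_comp,
      show (U.submatrix (maya hr _ hmu) (maya hr _ hlam)).submatrix ρ π =
        ((U.submatrix (maya hr _ hmu) (maya hr _ hlam)).submatrix ρ id).submatrix id π from rfl,
      det_permute', det_permute, hπs, hρs, submatrix_id_id, pow_add]
    push_cast
    ring
  have hblock : (fromBlocks 0 (-U.submatrix c a)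
      ((U.submatrix (Fin.castLE hr) (Fin.castLE hr))⁻¹.submatrix b d)
      (((U.submatrix (Fin.castLE hr) (Fin.castLE hr))⁻¹ *
        U.submatrix (Fin.castLE hr) a).submatrix b id)).det =
      frobeniusDet (rowEntry U r) (colEntry hr U) (hookEntry hr U) α.1 β.1 γ.1 δ.1 := by
    rw [frobeniusDet]
    congr 1
    ext (i | i) (j | j)
    · rfl
    · simp only [fromBlocks_apply₁₂, Matrix.neg_apply, submatrix_apply, of_apply, rowEntry]
      rw [natEntry_eq _ (c i).2 (a j).2]
    · simp only [fromBlocks_apply₂₁, submatrix_apply, of_apply, colEntry]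
      rw [natEntry_eq _ (b i).2 (d j).2]
    · simp only [fromBlocks_apply₂₂, submatrix_apply, of_apply, hookEntry]
      rw [natEntry_eq _ (b i).2 (a j).2]
      rfl
  rw [hperm, (hU.truncate hr).det_eq_one, one_mul, hblock] at key
  rw [← key, ← mul_assoc, ← mul_pow]
  simp

/-- A cell of `mu` outside `lam` gives a row `x` of `mu` longer than that of `lam`; at place `r - 1
- x` the row index then exceeds the column index. Thus the convention `S = 0` for `mu ⊄ lam` agrees
with the value of the minor, and no case distinction on containment is needed in the identities. -/
theorem det_maya_eq_zero {R : Type*} [CommRing R] {N r : ℕ} (hr : r ≤ N)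
    {U : Matrix (Fin N) (Fin N) R} (hU : IsUpperUnitriangular U) {lam mu : YoungDiagram}
    (hlam : lam ≤ rectangle r (N - r)) (hmu : mu ≤ rectangle r (N - r)) (h : ¬ mu ≤ lam) :
    (U.submatrix (maya hr mu hmu) (maya hr lam hlam)).det = 0 := by
  have hex : ∃ c, c ∈ mu ∧ c ∉ lam := by
    by_contra hcon
    push Not at hcon
    exact h hcon
  obtain ⟨⟨x, y⟩, h1, h2⟩ := hex
  have hx := (mem_rectangle.mp (hmu h1)).1
  simp only at hx
  rw [YoungDiagram.mem_iff_lt_rowLen] at h1 h2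
  refine det_eq_zero_of_upper _ ⟨r - 1 - x, by omega⟩ fun i j hi hj => hU.lower _ _ ?_
  have e1 := (maya_strictMono hr mu hmu).monotone hi
  have e2 := (maya_strictMono hr lam hlam).monotone hj
  simp only [Fin.le_def, maya_val, show r - 1 - (r - 1 - x) = x by omega] at e1 e2
  simp only [Fin.lt_def, maya_val]
  omega

/-! ### The generic matrix -/

theorem genericPlus_isUpperUnitriangular (N : ℕ) : IsUpperUnitriangular (genericPlus N) := by
  obtain ⟨L, D, h⟩ := genericPlus_spec N
  exact ⟨h.plus_diag, h.plus_upper⟩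

theorem ninthSchur_eq_det {N r : ℕ} (hr : r ≤ N) {lam mu : YoungDiagram}
    (hlam : lam ≤ rectangle r (N - r)) (hmu : mu ≤ rectangle r (N - r)) :
    ninthSchur N r lam mu =
      ((genericPlus N).submatrix (maya hr mu hmu) (maya hr lam hlam)).det := by
  by_cases h : mu ≤ lam
  · exact dif_pos ⟨h, hr, hlam⟩
  · rw [det_maya_eq_zero hr (genericPlus_isUpperUnitriangular N) hlam hmu h]
    exact dif_neg fun h' => h h'.1

theorem ninthSchur_eq_frobeniusDet {N r : ℕ} (hr : r ≤ N) {p q : ℕ} {α β : DecSeq p}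
    {γ δ : DecSeq q} (hlam : frobeniusDiagram α β ≤ rectangle r (N - r))
    (hmu : frobeniusDiagram γ δ ≤ rectangle r (N - r)) :
    ninthSchur N r (frobeniusDiagram α β) (frobeniusDiagram γ δ) =
      (-1) ^ (∑ j, β.1 j + ∑ l, δ.1 l) *
        frobeniusDet (rowEntry (genericPlus N) r) (colEntry hr (genericPlus N))
          (hookEntry hr (genericPlus N)) α.1 β.1 γ.1 δ.1 := by
  rw [ninthSchur_eq_det hr hlam hmu,
    det_maya_eq_frobeniusDet hr (genericPlus_isUpperUnitriangular N) hlam hmu]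

/-! ### Row and column functions as matrix entries -/

theorem rowLen_rectangle {r s i : ℕ} : (rectangle r s).rowLen i = if i < r then s else 0 := by
  refine rowLen_eq_of_mem_iff fun y => ?_
  rw [mem_rectangle]
  split_ifs with h <;> simp [h]

theorem rowLen_bot (i : ℕ) : (⊥ : YoungDiagram).rowLen i = 0 :=
  rowLen_eq_of_mem_iff fun y => by simp

theorem rectangle_le_rectangle {a b r s : ℕ} (h : (a ≤ r ∧ b ≤ s) ∨ a = 0 ∨ b = 0) :
    rectangle a b ≤ rectangle r s := by
  rintro ⟨x, y⟩ hxy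
  rw [mem_rectangle] at hxy ⊢
  simp only at hxy ⊢
  omega

/-- For `γ ≤ α` the minor has rows `0, …, r + γ` and columns `0, …, r + γ - 1, r + α`. It is
triangular with ones on the diagonal except for its last entry. For `α < γ` both sides vanish. -/
theorem hFun_eq_rowEntry {N r γ α : ℕ} (hγ : r + γ < N) (hα : r + α < N) :
    hFun N (r + γ + 1) ((α : ℤ) - (γ : ℤ)) = rowEntry (genericPlus N) r γ α := by
  have hU := genericPlus_isUpperUnitriangular N
  rw [hFun, rowEntry, natEntry_eq _ hγ hα]
  split_ifs with h
  · exact (hU.lower _ _ (by rw [Fin.lt_def]; simp only; omega)).symm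
  · obtain ⟨d, rfl⟩ : ∃ d, α = γ + d := ⟨α - γ, by omega⟩
    have hd : (((γ + d : ℕ) : ℤ) - (γ : ℤ)).toNat = d := by omega
    rw [hd, ninthSchur_eq_det (by omega) (rectangle_le_rectangle (Or.inl (by omega))) bot_le]
    rw [det_of_isUpperTriangular, Fin.prod_univ_castSucc, Finset.prod_eq_one, one_mul]
    · rw [submatrix_apply]
      congr 1 <;> ext <;>
        simp only [maya_val, rowLen_bot, rowLen_rectangle, Fin.val_last]
      · omega
      · rw [if_pos (by omega)]
        omega
    · intro i _
      rw [submatrix_apply]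
      convert hU.diag _ using 2
      have hi := i.2
      ext
      simp only [maya_val, rowLen_bot, rowLen_rectangle, Fin.val_castSucc]
      rw [if_neg (by omega)]
    · intro i j hij
      have hij' : (j : ℕ) < i := hij
      have hi := i.2
      rw [submatrix_apply]
      refine hU.lower _ _ ?_
      simp only [Fin.lt_def, maya_val, rowLen_bot, rowLen_rectangle]
      rw [if_neg (by omega)]
      omega

/-- For `δ ≤ β` put `t = r - δ - 1` and `d = β - δ`. The Maya diagram of a column of `d` cells is
`{0, …, t}` without `t - d`, so the minor is the one that omits the last row and column `t - d` of
the leading block of order `t + 1`. Up to sign it is an entry of the inverse of that block, which is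
a truncation of the inverse of the `r × r` block. -/
theorem eFun_eq_colEntry {N r δ β : ℕ} (hr : r ≤ N) (hδ : δ < r) (hβ : β < r) :
    eFun N (r - δ - 1) ((β : ℤ) - (δ : ℤ)) =
      (-1) ^ (β + δ) * colEntry hr (genericPlus N) β δ := by
  have hU := genericPlus_isUpperUnitriangular N
  set A := (genericPlus N).submatrix (Fin.castLE hr) (Fin.castLE hr) with hA
  have hAU : IsUpperUnitriangular A := hU.truncate hr
  rw [eFun, colEntry, natEntry_eq _ (i := r - 1 - β) (j := r - 1 - δ) (by omega) (by omega)]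
  split_ifs with h
  · rw [hAU.inv_lower, mul_zero]
    rw [Fin.lt_def]
    simp only
    omega
  · obtain ⟨d, rfl⟩ : ∃ d, β = δ + d := ⟨β - δ, by omega⟩
    have hd : (((δ + d : ℕ) : ℤ) - (δ : ℤ)).toNat = d := by omega
    obtain ⟨t, rfl⟩ : ∃ t, r = t + δ + 1 := ⟨r - δ - 1, by omega⟩
    have ht : t + δ + 1 - δ - 1 = t := by omega
    rw [hd]
    simp only [ht]
    rw [ninthSchur_eq_det (by omega) (rectangle_le_rectangle (Or.inl (by omega))) bot_le]
    have htr : t + 1 ≤ t + δ + 1 := by omega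
    have hinv := hAU.inv_truncate htr
    set T := A.submatrix (Fin.castLE htr) (Fin.castLE htr) with hT
    have hentry : A⁻¹ ⟨t + δ + 1 - 1 - (δ + d), by omega⟩ ⟨t + δ + 1 - 1 - δ, by omega⟩ =
        T⁻¹ ⟨t - d, by omega⟩ (Fin.last t) := by
      rw [hinv, submatrix_apply]
      exact congrArg₂ _ (Fin.ext (by simp only [Fin.val_castLE]; omega))
        (Fin.ext (by simp only [Fin.val_castLE, Fin.val_last]; omega))
    have hTdet : T.det = 1 := (hAU.truncate htr).det_eq_one
    rw [hentry, Matrix.inv_def, hTdet, Ring.inverse_one, one_smul,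
      adjugate_fin_succ_eq_det_submatrix, ← mul_assoc, ← pow_add]
    -- The cofactor sign `(-1) ^ (t + (t - d))` and the stated sign `(-1) ^ (β + δ)` have the same
    -- parity.
    have hsign : (-1 : RatFun N) ^ (δ + d + δ + (((Fin.last t : Fin (t + 1)) : ℕ) + (t - d))) =
        1 := by
      rw [Fin.val_last, show δ + d + δ + (t + (t - d)) = 2 * (δ + t) by omega, pow_mul]
      simp
    rw [hsign, one_mul]
    congr 1
    ext i j
    rw [submatrix_apply, hT, hA, submatrix_apply, submatrix_apply, submatrix_apply]
    have hj := j.2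
    congr 1 <;> ext
    · simp [maya_val, rowLen_bot]
    · simp only [maya_val, rowLen_rectangle, Fin.succAbove, Fin.lt_def, Fin.val_castLE,
        Fin.val_castSucc]
      split_ifs <;> simp <;> omega

/-! ### The two identities for the generic matrix -/

theorem frobeniusDiagram_zero (α β : DecSeq 0) : frobeniusDiagram α β = ⊥ := by
  refine SetLike.ext fun ⟨x, y⟩ => ?_
  rw [mem_frobeniusDiagram]
  simp

theorem DecSeq.remove_eq {p : ℕ} (a : DecSeq (p + 1)) (i : Fin (p + 1)) :
    (a.remove i).1 = a.1 ∘ i.succAbove := rfl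

theorem DecSeq.dropFirst_eq {p : ℕ} (a : DecSeq (p + 1)) : a.dropFirst.1 = a.1 ∘ Fin.succ :=
  funext a.dropFirst_apply

theorem DecSeq.dropLast_eq {p : ℕ} (a : DecSeq (p + 1)) : a.dropLast.1 = a.1 ∘ Fin.castSucc :=
  funext a.dropLast_apply

/-- In each of the three products the first and last terms of `β` are counted once and every inner
term twice, so the signs from `ninthSchur_eq_frobeniusDet` form a common factor of
`frobeniusDet_hook_identity`. -/
theorem ninthSchur_hook_identity {N r : ℕ} (hr : r ≤ N) {p : ℕ} (α β : DecSeq (p + 2))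
    (hlam : frobeniusDiagram α β ≤ rectangle r (N - r)) :
    ninthSchur N r (frobeniusDiagram α β) ⊥ *
        ninthSchur N r (frobeniusDiagram α.dropFirst.dropLast β.dropFirst.dropLast) ⊥ =
      ninthSchur N r (frobeniusDiagram α.dropLast β.dropLast) ⊥ *
          ninthSchur N r (frobeniusDiagram α.dropFirst β.dropFirst) ⊥ -
        ninthSchur N r (frobeniusDiagram α.dropFirst β.dropLast) ⊥ *
          ninthSchur N r (frobeniusDiagram α.dropLast β.dropFirst) ⊥ := by
  let z : DecSeq 0 := ⟨Fin.elim0, fun i => i.elim0⟩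
  have hbot : frobeniusDiagram z z ≤ rectangle r (N - r) := by
    rw [frobeniusDiagram_zero]
    exact bot_le
  have hsub := frobeniusDiagram_remove_le_rectangle hlam
  simp only [DecSeq.dropFirst, DecSeq.dropLast]
  rw [← frobeniusDiagram_zero z z, ninthSchur_eq_frobeniusDet hr hlam hbot,
    ninthSchur_eq_frobeniusDet hr (frobeniusDiagram_remove_le_rectangle (hsub 0 0) _ _) hbot,
    ninthSchur_eq_frobeniusDet hr (hsub _ _) hbot, ninthSchur_eq_frobeniusDet hr (hsub _ _) hbot,
    ninthSchur_eq_frobeniusDet hr (hsub _ _) hbot, ninthSchur_eq_frobeniusDet hr (hsub _ _) hbot]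
  have key := frobeniusDet_hook_identity (rowEntry (genericPlus N) r)
    (colEntry hr (genericPlus N)) (hookEntry hr (genericPlus N)) α.1 β.1 z.1 z.1
  have hmid : ∀ a : DecSeq (p + 2),
      a.dropFirst.dropLast.1 = fun k : Fin p => a.1 k.castSucc.succ := fun a => by
    rw [DecSeq.dropLast_eq, DecSeq.dropFirst_eq]
    rfl
  have s1 : ∑ j, β.1 j = β.1 0 + ∑ j, β.dropFirst.1 j := by
    rw [Fin.sum_univ_succ, DecSeq.dropFirst_eq]
    rfl
  have s2 : ∑ j, β.dropFirst.1 j = ∑ j, β.dropFirst.dropLast.1 j + β.1 (Fin.last (p + 1)) := by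
    rw [Fin.sum_univ_castSucc, DecSeq.dropLast_eq β.dropFirst, DecSeq.dropFirst_eq]
    rfl
  have s3 : ∑ j, β.dropLast.1 j = β.1 0 + ∑ j, β.dropFirst.dropLast.1 j := by
    rw [Fin.sum_univ_succ, DecSeq.dropLast_eq β.dropFirst, DecSeq.dropFirst_eq, DecSeq.dropLast_eq]
    rfl
  rw [← hmid, ← hmid, ← DecSeq.dropFirst_eq, ← DecSeq.dropFirst_eq, ← DecSeq.dropLast_eq,
    ← DecSeq.dropLast_eq] at key
  simp only [DecSeq.dropFirst, DecSeq.dropLast] at key s1 s2 s3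
  rw [s1, s3, s2]
  simp only [pow_add]
  linear_combination (-1 : RatFun N) ^ β.1 0 * (-1) ^ β.1 (Fin.last (p + 1)) *
    ((-1) ^ ∑ j, ((β.remove 0).remove (Fin.last p)).1 j) ^ 2 * ((-1) ^ ∑ l, z.1 l) ^ 2 * key

/-- Modulo 2 every product carries the exponent `∑ β + ∑ ⁻β + δ_q`. In the summands, the sign `(-1)
^ (β_j + δ_q)` from `eFun_eq_colEntry` restores the omitted `β_j` and supplies the `δ_q`. -/
theorem ninthSchur_skew_identity {N r : ℕ} (hr : r ≤ N) {p q : ℕ} (α β : DecSeq (p + 1))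
    (γ δ : DecSeq (q + 1)) (hlam : frobeniusDiagram α β ≤ rectangle r (N - r))
    (hmu : frobeniusDiagram γ δ ≤ rectangle r (N - r)) :
    ninthSchur N r (frobeniusDiagram α β) (frobeniusDiagram γ δ) *
        ninthSchur N r (frobeniusDiagram α.dropFirst β.dropFirst)
          (frobeniusDiagram γ.dropLast δ.dropLast) =
      ninthSchur N r (frobeniusDiagram α β) (frobeniusDiagram γ.dropLast δ.dropLast) *
          ninthSchur N r (frobeniusDiagram α.dropFirst β.dropFirst) (frobeniusDiagram γ δ) +
        ∑ i : Fin (p + 1), ∑ j : Fin (p + 1), (-1) ^ ((i : ℕ) + (j : ℕ)) *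
          hFun N (r + γ.1 (Fin.last q) + 1) ((α.1 i : ℤ) - (γ.1 (Fin.last q) : ℤ)) *
          eFun N (r - δ.1 (Fin.last q) - 1) ((β.1 j : ℤ) - (δ.1 (Fin.last q) : ℤ)) *
          ninthSchur N r (frobeniusDiagram (α.remove i) β.dropFirst)
            (frobeniusDiagram γ.dropLast δ.dropLast) *
          ninthSchur N r (frobeniusDiagram α.dropFirst (β.remove j))
            (frobeniusDiagram γ.dropLast δ.dropLast) := by
  have hl := frobeniusDiagram_le_rectangle.mp hlam
  have hm := frobeniusDiagram_le_rectangle.mp hmu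
  have hsub : ∀ i j, frobeniusDiagram (α.remove i) (β.remove j) ≤ rectangle r (N - r) :=
    frobeniusDiagram_remove_le_rectangle hlam
  have hsub' : frobeniusDiagram γ.dropLast δ.dropLast ≤ rectangle r (N - r) :=
    frobeniusDiagram_remove_le_rectangle hmu _ _
  have key := frobeniusDet_skew_identity (rowEntry (genericPlus N) r)
    (colEntry hr (genericPlus N)) (hookEntry hr (genericPlus N)) α.1 β.1 γ.1 δ.1
  have s1 : ∀ j, ∑ k, β.1 k = β.1 j + ∑ k, (β.remove j).1 k := fun j => Fin.sum_univ_succAbove _ j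
  have s2 : ∑ l, δ.1 l = ∑ l, δ.dropLast.1 l + δ.1 (Fin.last q) := by
    rw [Fin.sum_univ_castSucc, DecSeq.dropLast_eq]
    rfl
  have sq : ∀ n : ℕ, (-1 : RatFun N) ^ n * (-1) ^ n = 1 := fun n => by
    rw [← mul_pow]
    simp
  have hsum : ∀ i j : Fin (p + 1), (-1 : RatFun N) ^ ((i : ℕ) + (j : ℕ)) *
      hFun N (r + γ.1 (Fin.last q) + 1) ((α.1 i : ℤ) - (γ.1 (Fin.last q) : ℤ)) *
      eFun N (r - δ.1 (Fin.last q) - 1) ((β.1 j : ℤ) - (δ.1 (Fin.last q) : ℤ)) *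
      ninthSchur N r (frobeniusDiagram (α.remove i) β.dropFirst)
        (frobeniusDiagram γ.dropLast δ.dropLast) *
      ninthSchur N r (frobeniusDiagram α.dropFirst (β.remove j))
        (frobeniusDiagram γ.dropLast δ.dropLast) =
      (-1) ^ (∑ k, β.1 k + ∑ k, β.dropFirst.1 k + δ.1 (Fin.last q)) *
        ((-1) ^ ((i : ℕ) + (j : ℕ)) *
          rowEntry (genericPlus N) r (γ.1 (Fin.last q)) (α.1 i) *
          colEntry hr (genericPlus N) (β.1 j) (δ.1 (Fin.last q)) *
          frobeniusDet (rowEntry (genericPlus N) r) (colEntry hr (genericPlus N))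
            (hookEntry hr (genericPlus N)) (α.1 ∘ i.succAbove) (β.1 ∘ Fin.succ)
            (γ.1 ∘ Fin.castSucc) (δ.1 ∘ Fin.castSucc) *
          frobeniusDet (rowEntry (genericPlus N) r) (colEntry hr (genericPlus N))
            (hookEntry hr (genericPlus N)) (α.1 ∘ Fin.succ) (β.1 ∘ j.succAbove)
            (γ.1 ∘ Fin.castSucc) (δ.1 ∘ Fin.castSucc)) := by
    intro i j
    have h1 := hl i
    have h2 := hl j
    have h3 := hm (Fin.last q)
    rw [hFun_eq_rowEntry (by omega) (by omega), eFun_eq_colEntry hr (by omega) (by omega),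
      ninthSchur_eq_frobeniusDet (α := α.remove i) (β := β.dropFirst) hr (hsub i 0) hsub',
      ninthSchur_eq_frobeniusDet (α := α.dropFirst) (β := β.remove j) hr (hsub 0 j) hsub',
      DecSeq.dropFirst_eq α, ← DecSeq.dropFirst_eq β, ← DecSeq.dropLast_eq, ← DecSeq.dropLast_eq,
      ← DecSeq.remove_eq, ← DecSeq.remove_eq, s1 j]
    simp only [pow_add]
    linear_combination (-1 : RatFun N) ^ (i : ℕ) * (-1) ^ (j : ℕ) * (-1) ^ β.1 j *
      (-1) ^ (∑ k, (β.remove j).1 k) * (-1) ^ (∑ k, β.dropFirst.1 k) * (-1) ^ δ.1 (Fin.last q) *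
      rowEntry (genericPlus N) r (γ.1 (Fin.last q)) (α.1 i) *
      colEntry hr (genericPlus N) (β.1 j) (δ.1 (Fin.last q)) *
      frobeniusDet (rowEntry (genericPlus N) r) (colEntry hr (genericPlus N))
        (hookEntry hr (genericPlus N)) (α.remove i).1 β.dropFirst.1 γ.dropLast.1 δ.dropLast.1 *
      frobeniusDet (rowEntry (genericPlus N) r) (colEntry hr (genericPlus N))
        (hookEntry hr (genericPlus N)) (α.1 ∘ Fin.succ) (β.remove j).1 γ.dropLast.1
        δ.dropLast.1 * sq (∑ l, δ.dropLast.1 l)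
  simp only [hsum, ← Finset.mul_sum]
  -- The double sum, now freed of signs depending on `i` and `j` other than `(-1) ^ (i + j)`, is
  -- replaced by the difference of products of determinants to which it is equal.
  rw [eq_sub_of_add_eq' key.symm, ninthSchur_eq_frobeniusDet hr hlam hmu,
    ninthSchur_eq_frobeniusDet hr hlam hsub',
    ninthSchur_eq_frobeniusDet (α := α.dropFirst) (β := β.dropFirst) hr (hsub 0 0) hsub',
    ninthSchur_eq_frobeniusDet (α := α.dropFirst) (β := β.dropFirst) hr (hsub 0 0) hmu,
    ← DecSeq.dropFirst_eq, ← DecSeq.dropFirst_eq, ← DecSeq.dropLast_eq, ← DecSeq.dropLast_eq, s2]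
  set H := rowEntry (genericPlus N) r
  set E := colEntry hr (genericPlus N)
  set P := hookEntry hr (genericPlus N)
  simp only [pow_add]
  linear_combination (-1 : RatFun N) ^ (∑ k, β.1 k) * (-1) ^ (∑ k, β.dropFirst.1 k) *
    (-1) ^ δ.1 (Fin.last q) *
    (frobeniusDet H E P α.1 β.1 γ.1 δ.1 *
        frobeniusDet H E P α.dropFirst.1 β.dropFirst.1 γ.dropLast.1 δ.dropLast.1 -
      frobeniusDet H E P α.1 β.1 γ.dropLast.1 δ.dropLast.1 *
        frobeniusDet H E P α.dropFirst.1 β.dropFirst.1 γ.1 δ.1) * sq (∑ l, δ.dropLast.1 l)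

end NinthVariation

/-- The lengths `p + 2` and `q + 1` encode `p ≥ 2` and `q ≥ 1`. In the second part `α` and `β` may
be given length `p + 1`, because a nonempty `mu` inside `lam` forces `lam` to have a diagonal cell.
-/
theorem mainTheorem4 (r s : ℕ) (lam mu : YoungDiagram) (hmu : mu ≤ lam)
    (hlam : lam ≤ rectangle r s) :
    (∀ (p : ℕ) (α β : DecSeq (p + 2)),
      HasFrobenius lam α β →
      ninthSchur (r + s) r lam ⊥ *
          ninthSchur (r + s) r
            (frobeniusDiagram α.dropFirst.dropLast β.dropFirst.dropLast) ⊥ =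
        ninthSchur (r + s) r
            (frobeniusDiagram α.dropLast β.dropLast) ⊥ *
          ninthSchur (r + s) r
            (frobeniusDiagram α.dropFirst β.dropFirst) ⊥ -
        ninthSchur (r + s) r
            (frobeniusDiagram α.dropFirst β.dropLast) ⊥ *
          ninthSchur (r + s) r
            (frobeniusDiagram α.dropLast β.dropFirst) ⊥) ∧
    (∀ (p q : ℕ) (α β : DecSeq (p + 1)) (γ δ : DecSeq (q + 1)),
      HasFrobenius lam α β →
      HasFrobenius mu γ δ →
      ninthSchur (r + s) r lam mu *
          ninthSchur (r + s) r
            (frobeniusDiagram α.dropFirst β.dropFirst)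
            (frobeniusDiagram γ.dropLast δ.dropLast) =
        ninthSchur (r + s) r lam
            (frobeniusDiagram γ.dropLast δ.dropLast) *
          ninthSchur (r + s) r
            (frobeniusDiagram α.dropFirst β.dropFirst) mu +
        ∑ i : Fin (p + 1), ∑ j : Fin (p + 1),
          (-1) ^ ((i : ℕ) + (j : ℕ)) *
            hFun (r + s) (r + γ.1 (Fin.last q) + 1)
              ((α.1 i : ℤ) - (γ.1 (Fin.last q) : ℤ)) *
            eFun (r + s) (r - δ.1 (Fin.last q) - 1)
              ((β.1 j : ℤ) - (δ.1 (Fin.last q) : ℤ)) *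
            ninthSchur (r + s) r
              (frobeniusDiagram (α.remove i) β.dropFirst)
              (frobeniusDiagram γ.dropLast δ.dropLast) *
            ninthSchur (r + s) r
              (frobeniusDiagram α.dropFirst (β.remove j))
              (frobeniusDiagram γ.dropLast δ.dropLast)) := by
  have hlam' : lam ≤ rectangle r (r + s - r) := by rwa [Nat.add_sub_cancel_left]
  refine ⟨fun p α β h => ?_, fun p q α β γ δ h h' => ?_⟩
  · obtain rfl := hasFrobenius_iff.mp h
    exact ninthSchur_hook_identity (Nat.le_add_right r s) α β hlam'
  · obtain rfl := hasFrobenius_iff.mp h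
    obtain rfl := hasFrobenius_iff.mp h'
    exact ninthSchur_skew_identity (Nat.le_add_right r s) α β γ δ hlam' (hmu.trans hlam')
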